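/- \textbf{Model.} Consider the uplink of $L$ cells with $K$ users each and $N$ antennas at every base station (BS), in one coherence block of $T$ channel uses. Distinct channel uses $\tau_1,\dots,\tau_B\in\{1,\dots,T\}$ carry pilots and $\mathcal D=\{1,\dots,T\}\setminus\{\tau_1,\dots,\tau_B\}$ carry data. User $k$ of cell $l$ sends $x_{lk}(t)$: the deterministic pilot sequence $\tilde{\mathbf x}_{lk}=[x_{lk}(\tau_1)\,\dots\,x_{lk}(\tau_B)]^{T}\in\mathbb C^{B}$ at the pilot times, and random symbols with $\mathbb E|x_{lk}(t)|^2=p_{lk}$ for $t\in\mathcal D$. BS $j$ receives $$\mathbf y_j(t)=\mathbf D_{\boldsymbol\phi_j(t)}\sum_{l,k}\mathbf h_{jlk}x_{lk}(t)+\boldsymbol\upsilon_j(t)+\boldsymbol\eta_j(t),\qquad \mathbf D_{\boldsymbol\phi_j(t)}=\mathrm{diag}\big(e^{\imath\phi_{j1}(t)},\dots,e^{\imath\phi_{jN}(t)}\big).$$ The channels $\mathbf h_{jlk}\sim\mathcal{CN}(\mathbf 0,\mathbf\Lambda_{jlk})$, $\mathbf\Lambda_{jlk}=\mathrm{diag}(\lambda_{jlk}^{(1)},\dots,\lambda_{jlk}^{(N)})$,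 of different users are independent. Each phase drift satisfies that $\phi_{jn}(t)-\phi_{jn}(t-1)\sim\mathcal N(0,\delta)$ is independent of the past of $\phi_{jn}$. The noise $\boldsymbol\eta_j(t)\sim\mathcal{CN}(\mathbf 0,\xi\mathbf I_N)$, $\xi>0$, is independent over $t$. Channels, phase drifts and $\boldsymbol\eta_j$ are independent. Conditionally on them, the distortion noises $\boldsymbol\upsilon_j(t)$, $t=1,\dots,T$, are independent with $\boldsymbol\upsilon_j(t)\sim\mathcal{CN}\big(\mathbf 0,\kappa^2\sum_{l,k}\mathbb E|x_{lk}(t)|^2\,\mathrm{diag}(|h_{jlk}^{(1)}|^2,\dots,|h_{jlk}^{(N)}|^2)\big)$, $\kappa\ge 0$. At BS $j$ there is a \emph{common LO (CLO)} if $\phi_{jn}(t)$ is almost surely the same for all antennas $n$, and there are \emph{separate LOs (SLOs)} if the processes $\phi_{j1},\dots,\phi_{jN}$ are independent. \textbf{Notation.} $\mathbf e_n$ is the $n$th column of $\mathbf I_N$, $\mathbf h_{jlm}(t)=\mathbf D_{\boldsymbol\phi_j(t)}\mathbf h_{jlm}$, $\boldsymbol\psi_j=[\mathbf y_j^T(\tau_1)\,\dots\,\mathbf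 y_j^T(\tau_B)]^T\in\mathbb C^{BN}$, $\mathbf D_{\boldsymbol\delta(t)}=\mathrm{diag}(e^{-\frac\delta2|t-\tau_1|},\dots,e^{-\frac\delta2|t-\tau_B|})$, $\mathbf D_{|\tilde{\mathbf x}_{lm}|^2}=\mathrm{diag}(|x_{lm}(\tau_1)|^2,\dots,|x_{lm}(\tau_B)|^2)$, $[\bar{\mathbf X}_{lm}]_{b_1,b_2}=x_{lm}(\tau_{b_1})x_{lm}^*(\tau_{b_2})e^{-\frac\delta2|\tau_{b_1}-\tau_{b_2}|}$, $\mathbf X_{lm}=\bar{\mathbf X}_{lm}+\kappa^2\mathbf D_{|\tilde{\mathbf x}_{lm}|^2}$, and $\mathbf\Psi_j=\sum_{l,m}\mathbf X_{lm}\otimes\mathbf\Lambda_{jlm}+\xi\mathbf I_{BN}$. Put $$\mathbf Q_{jk,lm}=(\tilde{\mathbf x}_{jk}^{H}\mathbf D_{\boldsymbol\delta(t)}\otimes\mathbf\Lambda_{jjk})\mathbf\Psi_j^{-1}(\mathbf D_{\boldsymbol\delta(t)}^{H}\tilde{\mathbf x}_{lm}\otimes\mathbf\Lambda_{jlm}),\qquad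 \mathbf Q_{jk}=\mathbf Q_{jk,jk},$$ $$q_{n_1n_2}(\mathbf Y)=(\tilde{\mathbf x}_{jk}^{H}\mathbf D_{\boldsymbol\delta(t)}\otimes\mathbf e_{n_1}^{H})\mathbf\Psi_j^{-1}(\mathbf Y\otimes\mathbf e_{n_1}\mathbf e_{n_2}^{H})\mathbf\Psi_j^{-1}(\mathbf D_{\boldsymbol\delta(t)}^{H}\tilde{\mathbf x}_{jk}\otimes\mathbf e_{n_2})\qquad(\mathbf Y\in\mathbb C^{B\times B}).$$ \textbf{Theorem.} Let $t\in\mathcal D$, fix a cell $j$ and a user $k$, and let $\mathbf v=\hat{\mathbf h}_{jjk}(t)=(\tilde{\mathbf x}_{jk}^{H}\mathbf D_{\boldsymbol\delta(t)}\otimes\mathbf\Lambda_{jjk})\mathbf\Psi_j^{-1}\boldsymbol\psi_j$ be the MRC filter; it is the linear MMSE estimate of $\mathbf h_{jjk}(t)$ from $\boldsymbol\psi_j$, that is, it minimizes $\mathbb E\|\mathbf h_{jjk}(t)-\mathbf W\boldsymbol\psi_j\|^2$ over all estimates $\mathbf W\boldsymbol\psi_j$, $\mathbf W\in\mathbb C^{N\times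 BN}$. All the following expectations exist, and for all $l,m$ $$\mathbb E\|\mathbf v\|^2=\mathrm{tr}(\mathbf Q_{jk}),\qquad \mathbb E\{\mathbf v^{H}\mathbf h_{jjk}(t)\}=\mathbb E\|\mathbf v\|^2;$$ if there is a CLO at BS $j$, $$\mathbb E|\mathbf v^{H}\mathbf h_{jlm}(t)|^2=\mathrm{tr}(\mathbf\Lambda_{jlm}\mathbf Q_{jk})+\sum_{n_1,n_2=1}^{N}\lambda_{jjk}^{(n_1)}\lambda_{jlm}^{(n_1)}\lambda_{jjk}^{(n_2)}\lambda_{jlm}^{(n_2)}\,q_{n_1n_2}(\bar{\mathbf X}_{lm})+\sum_{n=1}^{N}\big(\lambda_{jjk}^{(n)}\lambda_{jlm}^{(n)}\big)^2 q_{nn}\big(\kappa^2\mathbf D_{|\tilde{\mathbf x}_{lm}|^2}\big);$$ if there are SLOs at BS $j$, $$\mathbb E|\mathbf v^{H}\mathbf h_{jlm}(t)|^2=\mathrm{tr}(\mathbf\Lambda_{jlm}\mathbf Q_{jk})+\big|\mathrm{tr}(\mathbf Q_{jk,lm})\big|^2+\sum_{n=1}^{N}\big(\lambda_{jjk}^{(n)}\lambda_{jlm}^{(n)}\big)^2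 q_{nn}\big(\mathbf X_{lm}-\mathbf D_{\boldsymbol\delta(t)}^{H}\tilde{\mathbf x}_{lm}\tilde{\mathbf x}_{lm}^{H}\mathbf D_{\boldsymbol\delta(t)}\big);$$ and $$\mathbb E|\mathbf v^{H}\boldsymbol\upsilon_j(t)|^2=\kappa^2\sum_{l=1}^{L}\sum_{m=1}^{K}p_{lm}\,\mathrm{tr}(\mathbf\Lambda_{jlm}\mathbf Q_{jk})+\kappa^2\sum_{l=1}^{L}\sum_{m=1}^{K}\sum_{n=1}^{N}p_{lm}\big(\lambda_{jjk}^{(n)}\lambda_{jlm}^{(n)}\big)^2 q_{nn}(\mathbf X_{lm}).$$ The formulas that mention neither CLO nor SLOs hold for any dependence of the phase drifts between the antennas. -/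

import Mathlib

open MeasureTheory ProbabilityTheory
open scoped NNReal Matrix Kronecker ComplexConjugate

/-- The circularly symmetric complex Gaussian law `CN(0, v)` on `ℂ`: independent real and
imaginary parts, each `N(0, v / 2)`. -/
noncomputable def circGaussian (v : ℝ≥0) : Measure ℂ :=
  ((gaussianReal 0 (v / 2)).prod (gaussianReal 0 (v / 2))).map
    (fun z : ℝ × ℝ => (z.1 : ℂ) + (z.2 : ℂ) * Complex.I)

/-- The law `CN(0, diag v)` on `ℂ^N`. -/
noncomputable def circGaussianVec {N : ℕ} (v : Fin N → ℝ≥0) : Measure (Fin N → ℂ) :=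
  Measure.pi (fun n => circGaussian (v n))

/-- Kronecker product `r ⊗ M` of a row `r` of length `B` with an `N × N` matrix, as an `N × BN`
matrix (the one-element index of the single row is dropped). -/
def rowKron {B N : ℕ} (r : Fin B → ℂ) (M : Matrix (Fin N) (Fin N) ℂ) :
    Matrix (Fin N) (Fin B × Fin N) ℂ :=
  (Matrix.replicateRow Unit r ⊗ₖ M).submatrix (fun n => ((), n)) id

/-- Kronecker product `c ⊗ M` of a column `c` of length `B` with an `N × N` matrix, as a `BN × N`
matrix. -/
def colKron {B N : ℕ} (c : Fin B → ℂ) (M : Matrix (Fin N) (Fin N) ℂ) :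
    Matrix (Fin B × Fin N) (Fin N) ℂ :=
  (Matrix.replicateCol Unit c ⊗ₖ M).submatrix id (fun n => ((), n))

/-- Kronecker product of two vectors. -/
def vecKron {B N : ℕ} (a : Fin B → ℂ) (e : Fin N → ℂ) : Fin B × Fin N → ℂ :=
  fun i => a i.1 * e i.2

/-- Deterministic parameters of an uplink with `L` cells, `K` users per cell, `N` antennas per base
station, coherence blocks of `T` channel uses and `B` pilot symbols. The channel uses `1, …, T` are
indexed by `Fin T`; all formulas involve only differences of time indices. -/
structure UplinkParams (L K N T B : ℕ) where
  /-- `lam j l k n`: average attenuation from user `k` of cell `l` to antenna `n` of BS `j` -/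
  lam : Fin L → Fin L → Fin K → Fin N → ℝ≥0
  /-- distortion noise level -/
  κ : ℝ≥0
  /-- innovation variance of the phase drifts -/
  δ : ℝ≥0
  /-- receiver noise variance -/
  ξ : ℝ≥0
  /-- transmit powers -/
  p : Fin L → Fin K → ℝ≥0
  /-- pilot times -/
  τ : Fin B → Fin T
  τ_injective : Function.Injective τ
  /-- pilot sequences -/
  pilot : Fin L → Fin K → Fin B → ℂ

namespace UplinkParams

variable {L K N T B : ℕ} (S : UplinkParams L K N T B)

/-- `Λ_{jlk}`, the channel covariance matrix. -/
noncomputable def Lam (j l : Fin L) (k : Fin K) : Matrix (Fin N) (Fin N) ℂ :=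
  Matrix.diagonal (fun n => ((S.lam j l k n : ℝ) : ℂ))

/-- The set `𝒟` of data channel uses. -/
def dataTimes : Set (Fin T) := (Set.range S.τ)ᶜ

/-- `exp (-δ/2 |s - t|)`. -/
noncomputable def decay (s t : Fin T) : ℝ :=
  Real.exp (-((S.δ : ℝ) / 2) * |((s : ℕ) : ℝ) - ((t : ℕ) : ℝ)|)

/-- `D_{δ(t)}`. -/
noncomputable def Dδ (t : Fin T) : Matrix (Fin B) (Fin B) ℂ :=
  Matrix.diagonal (fun b => (S.decay t (S.τ b) : ℂ))

/-- `D_{|x̃_{lm}|²}`. -/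
noncomputable def Dsq (l : Fin L) (m : Fin K) : Matrix (Fin B) (Fin B) ℂ :=
  Matrix.diagonal (fun b => ((‖S.pilot l m b‖ ^ 2 : ℝ) : ℂ))

/-- `X̄_{lm}`. -/
noncomputable def Xbar (l : Fin L) (m : Fin K) : Matrix (Fin B) (Fin B) ℂ :=
  Matrix.of fun b₁ b₂ =>
    if b₁ = b₂ then ((‖S.pilot l m b₁‖ ^ 2 : ℝ) : ℂ)
    else S.pilot l m b₁ * conj (S.pilot l m b₂) * (S.decay (S.τ b₁) (S.τ b₂) : ℂ)

/-- `X_{lm} = X̄_{lm} + κ² D_{|x̃_{lm}|²}`. -/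
noncomputable def X (l : Fin L) (m : Fin K) : Matrix (Fin B) (Fin B) ℂ :=
  S.Xbar l m + ((S.κ : ℝ) : ℂ) ^ 2 • S.Dsq l m

/-- `Ψ_j`. -/
noncomputable def Psi (j : Fin L) : Matrix (Fin B × Fin N) (Fin B × Fin N) ℂ :=
  (∑ l, ∑ m, S.X l m ⊗ₖ S.Lam j l m) + ((S.ξ : ℝ) : ℂ) • 1

/-- The row `x̃_{lk}ᴴ D_{δ(t)}`. -/
noncomputable def xRow (l : Fin L) (k : Fin K) (t : Fin T) : Fin B → ℂ :=
  star (S.pilot l k) ᵥ* S.Dδ t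

/-- The column `D_{δ(t)}ᴴ x̃_{lk}`. -/
noncomputable def xCol (l : Fin L) (k : Fin K) (t : Fin T) : Fin B → ℂ :=
  (S.Dδ t)ᴴ *ᵥ S.pilot l k

/-- The matrix `(x̃_{lk}ᴴ D_{δ(t)} ⊗ Λ_{jlk}) Ψ_j⁻¹` of the channel estimator. -/
noncomputable def estMatrix (j l : Fin L) (k : Fin K) (t : Fin T) :
    Matrix (Fin N) (Fin B × Fin N) ℂ :=
  rowKron (S.xRow l k t) (S.Lam j l k) * (S.Psi j)⁻¹

/-- `(x̃_{jk}ᴴ D_{δ(t)} ⊗ Λ_{jjk}) Ψ_j⁻¹ (D_{δ(t)}ᴴ x̃_{lm} ⊗ Λ_{jlm})`. -/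
noncomputable def crossMat (j : Fin L) (k : Fin K) (l : Fin L) (m : Fin K) (t : Fin T) :
    Matrix (Fin N) (Fin N) ℂ :=
  rowKron (S.xRow j k t) (S.Lam j j k) * (S.Psi j)⁻¹ * colKron (S.xCol l m t) (S.Lam j l m)

/-- The scalar
`(x̃_{jk}ᴴ D_{δ(t)} ⊗ e_{n₁}ᴴ) Ψ_j⁻¹ (Y ⊗ e_{n₁} e_{n₂}ᴴ) Ψ_j⁻¹ (D_{δ(t)}ᴴ x̃_{jk} ⊗ e_{n₂})`. -/
noncomputable def quad (j : Fin L) (k : Fin K) (t : Fin T) (Y : Matrix (Fin B) (Fin B) ℂ)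
    (n₁ n₂ : Fin N) : ℂ :=
  vecKron (S.xRow j k t) (Pi.single n₁ 1) ⬝ᵥ
    (((S.Psi j)⁻¹ * (Y ⊗ₖ Matrix.single n₁ n₂ (1 : ℂ)) * (S.Psi j)⁻¹) *ᵥ
      vecKron (S.xCol j k t) (Pi.single n₂ 1))

end UplinkParams

/-- The diagonal of the conditional covariance matrix of the distortion noise at time `t`, when the
channels to the base station under consideration are `c` and the random transmit signals are `x`:
`κ² ∑_{l,k} E|x_{lk}(t)|² |c_{lk}^{(n)}|²`. -/
noncomputable def distortionVar {Ω : Type*} [MeasurableSpace Ω] (P : Measure Ω) {L K N T : ℕ}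
    (κ : ℝ≥0) (x : Fin L → Fin K → Fin T → Ω → ℂ) (c : Fin L → Fin K → Fin N → ℂ)
    (t : Fin T) (n : Fin N) : ℝ≥0 :=
  κ ^ 2 * ∑ l, ∑ k, (∫ ω, ‖x l k t ω‖ ^ 2 ∂P).toNNReal * ‖c l k n‖₊ ^ 2

/-- The random quantities of the uplink in one coherence block: Rayleigh fading channels, phase
drifts, distortion noise and receiver noise at every base station, and the transmit signals, which
are the deterministic pilots at the pilot times and use full power at the data times. -/
structure Uplink {L K N T B : ℕ} (S : UplinkParams L K N T B)
    {Ω : Type*} [MeasurableSpace Ω] (P : Measure Ω) [IsProbabilityMeasure P] where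
  /-- `x l k t`: transmit signals -/
  x : Fin L → Fin K → Fin T → Ω → ℂ
  /-- `h j ω l k`: channels to BS `j` -/
  h : Fin L → Ω → Fin L → Fin K → Fin N → ℂ
  /-- `φ j ω t n`: phase drifts at BS `j` -/
  φ : Fin L → Ω → Fin T → Fin N → ℝ
  /-- `υ j ω t n`: distortion noise at BS `j` -/
  υ : Fin L → Ω → Fin T → Fin N → ℂ
  /-- `η j ω t n`: receiver noise at BS `j` -/
  η : Fin L → Ω → Fin T → Fin N → ℂ
  measurable_h : ∀ j, Measurable (h j)
  measurable_φ : ∀ j, Measurable (φ j)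
  measurable_υ : ∀ j, Measurable (υ j)
  measurable_η : ∀ j, Measurable (η j)
  x_pilot : ∀ l k b ω, x l k (S.τ b) ω = S.pilot l k b
  x_memLp : ∀ l k t, t ∈ S.dataTimes → MemLp (x l k t) 2 P
  x_power : ∀ l k t, t ∈ S.dataTimes → ∫ ω, ‖x l k t ω‖ ^ 2 ∂P = S.p l k
  /-- `h_{jlk} ∼ CN(0, Λ_{jlk})` -/
  h_law : ∀ j l k, P.map (fun ω => h j ω l k) = circGaussianVec (S.lam j l k)
  /-- the channels of the different users are independent -/
  h_indep : ∀ j, iIndepFun (fun (i : Fin L × Fin K) ω => h j ω i.1 i.2) P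
  /-- each phase drift equals the previous one plus an innovation with law `N(0, δ)` … -/
  φ_law : ∀ j n (s t : Fin T), (t : ℕ) = s + 1 →
    P.map (fun ω => φ j ω t n - φ j ω s n) = gaussianReal 0 S.δ
  /-- … that is independent of the past -/
  φ_indep : ∀ j n (s t : Fin T), (t : ℕ) = s + 1 →
    IndepFun (fun ω => φ j ω t n - φ j ω s n) (fun ω (r : Set.Iic s) => φ j ω r n) P
  /-- the receiver noise is `CN(0, ξ I_N)`, independently for the different channel uses -/
  η_law : ∀ j, P.map (η j) =
    Measure.pi (fun _ : Fin T => circGaussianVec (fun _ : Fin N => S.ξ))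
  /-- phase drifts, receiver noise and channels are mutually independent (see also the next field) -/
  φ_η_indep : ∀ j, IndepFun (φ j) (η j) P
  h_φ_η_indep : ∀ j, IndepFun (h j) (fun ω => (φ j ω, η j ω)) P
  /-- given the channels (and the phase drifts and the receiver noise), the distortion noise is
  `CN(0, Υ_j(t))`, independently for the different channel uses -/
  υ_law : ∀ j, ∀ᵐ c ∂(P.map (fun ω => (h j ω, φ j ω, η j ω))),
    condDistrib (υ j) (fun ω => (h j ω, φ j ω, η j ω)) P c =
      Measure.pi (fun t : Fin T => circGaussianVec (distortionVar P S.κ x c.1 t))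

namespace Uplink

variable {L K N T B : ℕ} {S : UplinkParams L K N T B}
  {Ω : Type*} [MeasurableSpace Ω] {P : Measure Ω} [IsProbabilityMeasure P] (U : Uplink S P)

/-- The effective channel `h_{jlk}(t) = D_{φ_j(t)} h_{jlk}`. -/
noncomputable def effChannel (j l : Fin L) (k : Fin K) (t : Fin T) (ω : Ω) : Fin N → ℂ :=
  Matrix.diagonal (fun n => Complex.exp (Complex.I * (U.φ j ω t n : ℂ))) *ᵥ U.h j ω l k

/-- The received signal
`y_j(t) = D_{φ_j(t)} ∑_l ∑_k h_{jlk} x_{lk}(t) + υ_j(t) + η_j(t)`. -/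
noncomputable def received (j : Fin L) (t : Fin T) (ω : Ω) : Fin N → ℂ :=
  Matrix.diagonal (fun n => Complex.exp (Complex.I * (U.φ j ω t n : ℂ))) *ᵥ
      (∑ l, ∑ k, U.x l k t ω • U.h j ω l k) + U.υ j ω t + U.η j ω t

/-- `ψ_j`, the stacked received signal `y_j(τ_1), …, y_j(τ_B)` of the pilot transmission. -/
noncomputable def pilotSignal (j : Fin L) (ω : Ω) : Fin B × Fin N → ℂ :=
  fun i => U.received j (S.τ i.1) ω i.2

/-- The channel estimate `ĥ_{jlk}(t)`. -/
noncomputable def estimate (j l : Fin L) (k : Fin K) (t : Fin T) (ω : Ω) : Fin N → ℂ :=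
  S.estMatrix j l k t *ᵥ U.pilotSignal j ω

/-- The MRC receive filter `v_{jk}(t) = ĥ_{jjk}(t)`. -/
noncomputable def mrc (j : Fin L) (k : Fin K) (t : Fin T) (ω : Ω) : Fin N → ℂ :=
  U.estimate j j k t ω

/-- Common local oscillator at BS `j`: the phase drifts are identical for all antennas. -/
def CommonLO (j : Fin L) : Prop :=
  ∀ n n' : Fin N, ∀ t : Fin T, ∀ᵐ ω ∂P, U.φ j ω t n = U.φ j ω t n'

/-- Separate local oscillators at BS `j`: the phase drifts of the antennas are independent. -/
def SeparateLOs (j : Fin L) : Prop :=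
  iIndepFun (fun (n : Fin N) ω (t : Fin T) => U.φ j ω t n) P

end Uplink

/-- `A` is the matrix of a linear minimum mean-squared error estimator of the random vector `g` from
the observation `ψ`: it minimizes `E‖g - W ψ‖²` over all matrices `W`. -/
def IsLMMSE {Ω : Type*} [MeasurableSpace Ω] (P : Measure Ω) {N : ℕ} {ι : Type*} [Fintype ι]
    (g : Ω → Fin N → ℂ) (ψ : Ω → ι → ℂ) (A : Matrix (Fin N) ι ℂ) : Prop :=
  ∀ W : Matrix (Fin N) ι ℂ,
    ∫⁻ ω, ‖WithLp.toLp 2 (g ω - A *ᵥ ψ ω)‖ₑ ^ 2 ∂P ≤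
      ∫⁻ ω, ‖WithLp.toLp 2 (g ω - W *ᵥ ψ ω)‖ₑ ^ 2 ∂P

/-!
Write `ψ` for the pilot signal, `g` for an effective channel and `v = Aψ` for the filter. All
quantities in question are moments of order at most four of `ψ`, `g` and the distortion noise `υ(t)`,
so the proof consists of a computation of these moments and of linear algebra with `Ψ_j`.

*Moments.* The law `CN(0, v)` is invariant under multiplication by the imaginary unit. Rotating a
single coordinate of a family of independent circular Gaussians by this unit kills every monomial,
with at most two factors and two conjugated factors, in which that coordinate and its conjugate do not
occur equally often. This yields Wick's formula (`integral_quartic_gaussianField`); the only input on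
actual values is `E|z|² = v` and `E|z|⁴ = 2v²`. Integrals over channels, phases, receiver noise and distortion noise factor, the
distortion being integrated out conditionally on the channels (`Uplink.integral_environment_mul`).
Hence in a weighted second moment `E[ψ_p ψ_q^* F J]` only the pairings signal–signal,
distortion–distortion and noise–noise remain (`Uplink.integral_pilotSignal_mul_conj_mul`). The
independent innovations of the phase drifts produce the factors `e^{-δ|s-t|/2}`
(`Uplink.integral_cis_mul_conj`). The outcome is that `Ψ_j` is the correlation matrix of `ψ`, and that
`E[ψ_p ψ_q^* g_{n₁}^* g_{n₂}]`, for `p` at antenna `n₁` and `q` at antenna `n₂`, is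
`1_{n₁ = n₂} λ Ψ_j(p, q)` plus `λ^{(n₁)} λ^{(n₂)}` times a kernel
(`Uplink.integral_pilotSignal_mul_conj_mul_effChannel`). For `n₁ = n₂` this kernel is always `X_{lm}`;
for `n₁ ≠ n₂` it is `X̄_{lm}` under a common oscillator, and of rank one under separate oscillators,
where the two phase factors are independent. The distortion noise at a data time enters only through
its conditional variance, that is, through the terms with `n₁ = n₂`.

*Linear algebra.* The receiver noise makes `Ψ_j` invertible (`Uplink.isUnit_det_Psi`), and since the
channels of different antennas are uncorrelated, `Ψ_j` and its inverse are block diagonal in the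
antenna index. So the estimate for antenna `n` uses only the observations at antenna `n`, the scalars
`q_{n₁n₂}(Y)` become sesquilinear forms in the coefficients of the estimator
(`UplinkParams.mul_quad_eq`), and the sums of the moments against these coefficients are the stated
expressions (`UplinkParams.sum_coeff_mul`). Optimality is the orthogonality principle: the error
`g - Aψ` is uncorrelated with `ψ` because `AΨ_j` is the cross-correlation of `g` and `ψ`.
-/

/-! ### Moments of circularly symmetric Gaussian fields -/

/-- The fourth moment is read off from the fourth derivative of the moment-generating function. -/
lemma integral_pow_four_gaussianReal (v : ℝ≥0) :
    ∫ x, x ^ 4 ∂(gaussianReal 0 v) = 3 * (v : ℝ) ^ 2 := by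
  have h0 : (0 : ℝ) ∈ interior (integrableExpSet id (gaussianReal 0 v)) := by simp
  have h := iteratedDeriv_mgf_zero h0 4
  have e : mgf id (gaussianReal 0 v) = fun t => Real.exp (v * t ^ 2 / 2) := by
    rw [mgf_id_gaussianReal]; simp
  have hE (t : ℝ) : HasDerivAt (fun t : ℝ => Real.exp (v * t ^ 2 / 2))
      (v * t * Real.exp (v * t ^ 2 / 2)) t := by
    have := (((hasDerivAt_pow 2 t).const_mul (v : ℝ)).div_const 2).exp
    convert this using 1; simp; ring
  have d1 : deriv (fun t : ℝ => Real.exp (v * t ^ 2 / 2)) =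
      fun t => v * t * Real.exp (v * t ^ 2 / 2) := funext fun t => (hE t).deriv
  have d2 : deriv (fun t : ℝ => v * t * Real.exp (v * t ^ 2 / 2)) =
      fun t => (v + v ^ 2 * t ^ 2) * Real.exp (v * t ^ 2 / 2) := funext fun t => by
    have := ((hasDerivAt_id t).const_mul (v : ℝ)).mul (hE t)
    refine this.deriv.trans ?_; simp; ring
  have d3 : deriv (fun t : ℝ => (v + v ^ 2 * t ^ 2) * Real.exp (v * t ^ 2 / 2)) =
      fun t => (3 * v ^ 2 * t + v ^ 3 * t ^ 3) * Real.exp (v * t ^ 2 / 2) := funext fun t => by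
    have := (((hasDerivAt_pow 2 t).const_mul ((v : ℝ) ^ 2)).const_add (v : ℝ)).mul (hE t)
    refine this.deriv.trans ?_; simp; ring
  have d4 : deriv (fun t : ℝ => (3 * v ^ 2 * t + v ^ 3 * t ^ 3) * Real.exp (v * t ^ 2 / 2)) 0 =
      3 * (v : ℝ) ^ 2 := by
    have := (((hasDerivAt_id (0 : ℝ)).const_mul (3 * (v : ℝ) ^ 2)).fun_add
      ((hasDerivAt_pow 3 (0 : ℝ)).const_mul ((v : ℝ) ^ 3))).mul (hE 0)
    refine this.deriv.trans ?_; simp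
  rw [e, iteratedDeriv_succ, iteratedDeriv_succ, iteratedDeriv_succ, iteratedDeriv_one, d1, d2, d3,
    d4] at h
  simpa using h.symm

lemma integral_sq_gaussianReal (v : ℝ≥0) : ∫ x, x ^ 2 ∂(gaussianReal 0 v) = (v : ℝ) := by
  have h := variance_fun_id_gaussianReal (μ := 0) (v := v)
  rw [variance_eq_integral (by fun_prop)] at h
  simpa using h

lemma integrable_pow_gaussianReal (v : ℝ≥0) (n : ℕ) :
    Integrable (fun x : ℝ => x ^ n) (gaussianReal 0 v) := by
  have h := (memLp_id_gaussianReal' (μ := 0) (v := v) n (by simp)).integrable_norm_pow'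
  refine h.mono' (by fun_prop) (ae_of_all _ fun x => ?_)
  simp

lemma measurable_ofReal_add_mul_I :
    Measurable (fun z : ℝ × ℝ => (z.1 : ℂ) + (z.2 : ℂ) * Complex.I) := by fun_prop

instance (v : ℝ≥0) : IsProbabilityMeasure (circGaussian v) :=
  Measure.isProbabilityMeasure_map measurable_ofReal_add_mul_I.aemeasurable

instance {N : ℕ} (v : Fin N → ℝ≥0) : IsProbabilityMeasure (circGaussianVec v) := by
  unfold circGaussianVec; infer_instance

lemma norm_sq_ofReal_add_mul_I (a b : ℝ) : ‖(a : ℂ) + (b : ℂ) * Complex.I‖ ^ 2 = a ^ 2 + b ^ 2 := by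
  rw [← Complex.normSq_eq_norm_sq, Complex.normSq_add_mul_I]

lemma integral_norm_sq_circGaussian (v : ℝ≥0) : ∫ z, ‖z‖ ^ 2 ∂(circGaussian v) = v := by
  rw [circGaussian, integral_map measurable_ofReal_add_mul_I.aemeasurable (by fun_prop)]
  simp_rw [norm_sq_ofReal_add_mul_I]
  have i2 := integrable_pow_gaussianReal (v / 2) 2
  rw [integral_add (i2.comp_fst _) (i2.comp_snd _), integral_fun_fst (fun x : ℝ => x ^ 2),
    integral_fun_snd (fun x : ℝ => x ^ 2)]
  simp [integral_sq_gaussianReal]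

lemma integral_norm_pow_four_circGaussian (v : ℝ≥0) :
    ∫ z, ‖z‖ ^ 4 ∂(circGaussian v) = 2 * (v : ℝ) ^ 2 := by
  rw [circGaussian, integral_map measurable_ofReal_add_mul_I.aemeasurable (by fun_prop)]
  have e (z : ℝ × ℝ) : ‖(z.1 : ℂ) + (z.2 : ℂ) * Complex.I‖ ^ 4 =
      z.1 ^ 4 + (2 * (z.1 ^ 2 * z.2 ^ 2) + z.2 ^ 4) := by
    rw [show 4 = 2 * 2 from rfl, pow_mul, norm_sq_ofReal_add_mul_I]; ring
  simp_rw [e]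
  have i2 := integrable_pow_gaussianReal (v / 2) 2
  have i4 := integrable_pow_gaussianReal (v / 2) 4
  have i22 := i2.mul_prod i2
  rw [integral_add (i4.comp_fst _) (Integrable.fun_add (i22.const_mul 2) (i4.comp_snd _)),
    integral_add (i22.const_mul 2) (i4.comp_snd _), integral_const_mul,
    integral_fun_fst (fun x : ℝ => x ^ 4), integral_fun_snd (fun x : ℝ => x ^ 4),
    integral_prod_mul (fun x : ℝ => x ^ 2) (fun x : ℝ => x ^ 2)]
  simp [integral_sq_gaussianReal, integral_pow_four_gaussianReal]
  ring

lemma memLp_id_circGaussian (v : ℝ≥0) : MemLp (fun z : ℂ => z) 4 (circGaussian v) := by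
  rw [circGaussian, memLp_map_measure_iff (by fun_prop) measurable_ofReal_add_mul_I.aemeasurable]
  have h : MemLp (fun x : ℝ => (x : ℂ)) 4 (gaussianReal 0 (v / 2)) :=
    (memLp_id_gaussianReal' (μ := 0) (v := v / 2) 4 (by simp)).ofReal
  exact (h.comp_fst _).add ((h.comp_snd _).mul_const Complex.I)

lemma measurePreserving_mul_I_circGaussian (v : ℝ≥0) :
    MeasurePreserving (fun z : ℂ => Complex.I * z) (circGaussian v) (circGaussian v) := by
  refine ⟨by fun_prop, ?_⟩
  have hneg : MeasurePreserving (fun x : ℝ => -x) (gaussianReal 0 (v / 2))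
      (gaussianReal 0 (v / 2)) := ⟨by fun_prop, by rw [gaussianReal_map_neg]; simp⟩
  have hrot : MeasurePreserving (fun z : ℝ × ℝ => (-z.2, z.1))
      ((gaussianReal 0 (v / 2)).prod (gaussianReal 0 (v / 2)))
      ((gaussianReal 0 (v / 2)).prod (gaussianReal 0 (v / 2))) :=
    (hneg.prod (MeasurePreserving.id _)).comp Measure.measurePreserving_swap
  conv_rhs => rw [circGaussian, ← hrot.map_eq]
  rw [circGaussian, Measure.map_map (by fun_prop) (by fun_prop),
    Measure.map_map (by fun_prop) (by fun_prop)]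
  congr 1
  ext z
  simp only [Function.comp_apply]
  push_cast
  linear_combination (z.2 : ℂ) * Complex.I_sq

/-- The law of a finite family of independent complex Gaussian vectors with independent entries
`z i n ∼ CN(0, w i n)`. -/
noncomputable abbrev gaussianField {ι : Type*} [Fintype ι] {N : ℕ} (w : ι → Fin N → ℝ≥0) :
    Measure (ι → Fin N → ℂ) :=
  Measure.pi fun i => circGaussianVec (w i)

section GaussianField

variable {ι : Type*} [Fintype ι] {N : ℕ} (w : ι → Fin N → ℝ≥0)

lemma measurePreserving_eval_gaussianField (i : ι) (n : Fin N) :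
    MeasurePreserving (fun z : ι → Fin N → ℂ => z i n) (gaussianField w)
      (circGaussian (w i n)) :=
  (measurePreserving_eval (fun n => circGaussian (w i n)) n).comp
    (measurePreserving_eval (fun i => circGaussianVec (w i)) i)

lemma memLp_eval_gaussianField (i : ι) (n : Fin N) :
    MemLp (fun z : ι → Fin N → ℂ => z i n) 4 (gaussianField w) :=
  (memLp_id_circGaussian (w i n)).comp_measurePreserving (measurePreserving_eval_gaussianField w i n)

lemma iIndepFun_eval_gaussianField :
    iIndepFun (fun (p : ι × Fin N) (z : ι → Fin N → ℂ) => z p.1 p.2) (gaussianField w) := by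
  refine iIndepFun_uncurry' (X := fun i n (z : ι → Fin N → ℂ) => z i n) (by fun_prop) ?_ fun i => ?_
  · exact iIndepFun_pi (X := fun _ (y : Fin N → ℂ) => y) (μ := fun i => circGaussianVec (w i))
      (by fun_prop)
  · rw [iIndepFun_iff_map_fun_eq_pi_map fun n => Measurable.aemeasurable (by fun_prop)]
    simp_rw [(measurePreserving_eval_gaussianField w i _).map_eq]
    exact (measurePreserving_eval (fun i => circGaussianVec (w i)) i).map_eq

/-- Rotating the coordinates in a set `s` by `90°` preserves the law of the field. -/
lemma integral_comp_rotate_gaussianField (s : ι → Fin N → Prop) [∀ i n, Decidable (s i n)]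
    (f : (ι → Fin N → ℂ) → ℂ) (hf : Measurable f) :
    ∫ z, f (fun i n => (if s i n then Complex.I else 1) * z i n) ∂(gaussianField w) =
      ∫ z, f z ∂(gaussianField w) := by
  have h : MeasurePreserving
      (fun (z : ι → Fin N → ℂ) i n => (if s i n then Complex.I else 1) * z i n)
      (gaussianField w) (gaussianField w) := by
    refine measurePreserving_pi (fun i => circGaussianVec (w i)) (fun i => circGaussianVec (w i))
      (f := fun i (y : Fin N → ℂ) n => (if s i n then Complex.I else 1) * y n) fun i => ?_
    refine measurePreserving_pi _ _
      (f := fun n (y : ℂ) => (if s i n then Complex.I else 1) * y) fun n => ?_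
    split_ifs
    · exact measurePreserving_mul_I_circGaussian _
    · simp only [one_mul]; exact MeasurePreserving.id _
  conv_rhs => rw [← h.map_eq]
  rw [integral_map h.measurable.aemeasurable hf.aestronglyMeasurable]

lemma eq_zero_of_mul_eq {c x : ℂ} (h : c * x = x) (hc : c ≠ 1) : x = 0 := by
  have : (c - 1) * x = 0 := by rw [sub_mul, h, one_mul, sub_self]
  exact (mul_eq_zero.1 this).resolve_left (sub_ne_zero.2 hc)

/-- A function that a rotation of some coordinates by `90°` multiplies by `c ≠ 1` has mean zero. -/
lemma integral_eq_zero_of_rotate (s : ι → Fin N → Prop) [∀ i n, Decidable (s i n)]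
    (f : (ι → Fin N → ℂ) → ℂ) (hf : Measurable f) (c : ℂ) (hc : c ≠ 1)
    (h : ∀ z, f (fun i n => (if s i n then Complex.I else 1) * z i n) = c * f z) :
    ∫ z, f z ∂(gaussianField w) = 0 := by
  have h' := integral_comp_rotate_gaussianField w s f hf
  simp_rw [h] at h'
  rw [integral_const_mul] at h'
  exact eq_zero_of_mul_eq h' hc

lemma integral_eval_gaussianField (i : ι) (n : Fin N) :
    ∫ z, z i n ∂(gaussianField w) = 0 :=
  integral_eq_zero_of_rotate w (fun _ _ => True) _ (by fun_prop) Complex.I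
    (by simp [Complex.ext_iff]) (by simp)

lemma integral_conj_gaussianField (i : ι) (n : Fin N) :
    ∫ z, conj (z i n) ∂(gaussianField w) = 0 :=
  integral_eq_zero_of_rotate w (fun _ _ => True) (fun z => conj (z i n)) (by fun_prop) (-Complex.I)
    (by simp [Complex.ext_iff]) (by simp)

lemma integral_cubic_gaussianField (a c d : ι × Fin N) :
    ∫ z, z a.1 a.2 * (conj (z c.1 c.2) * z d.1 d.2) ∂(gaussianField w) = 0 :=
  integral_eq_zero_of_rotate w (fun _ _ => True)
    (fun z => z a.1 a.2 * (conj (z c.1 c.2) * z d.1 d.2)) (by fun_prop) Complex.I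
    (by simp [Complex.ext_iff]) (fun z => by
      simp only [if_true, map_mul, Complex.conj_I]; linear_combination
        (-Complex.I * (z a.1 a.2 * (conj (z c.1 c.2) * z d.1 d.2))) * Complex.I_sq)

lemma integral_conj_cubic_gaussianField (b c d : ι × Fin N) :
    ∫ z, conj (z b.1 b.2) * (conj (z c.1 c.2) * z d.1 d.2) ∂(gaussianField w) = 0 :=
  integral_eq_zero_of_rotate w (fun _ _ => True)
    (fun z => conj (z b.1 b.2) * (conj (z c.1 c.2) * z d.1 d.2)) (by fun_prop) (-Complex.I)
    (by simp [Complex.ext_iff]) (fun z => by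
      simp only [if_true, map_mul, Complex.conj_I]; linear_combination
        (Complex.I * (conj (z b.1 b.2) * (conj (z c.1 c.2) * z d.1 d.2))) * Complex.I_sq)

lemma integral_norm_sq_gaussianField (a : ι × Fin N) :
    ∫ z, ‖z a.1 a.2‖ ^ 2 ∂(gaussianField w) = (w a.1 a.2 : ℝ) := by
  have h := measurePreserving_eval_gaussianField w a.1 a.2
  rw [← integral_norm_sq_circGaussian, ← h.map_eq,
    integral_map h.measurable.aemeasurable (by fun_prop)]

lemma integral_norm_pow_four_gaussianField (a : ι × Fin N) :
    ∫ z, ‖z a.1 a.2‖ ^ 4 ∂(gaussianField w) = 2 * (w a.1 a.2 : ℝ) ^ 2 := by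
  have h := measurePreserving_eval_gaussianField w a.1 a.2
  rw [← integral_norm_pow_four_circGaussian, ← h.map_eq,
    integral_map h.measurable.aemeasurable (by fun_prop)]

lemma integral_norm_sq_mul_norm_sq_gaussianField {a b : ι × Fin N} (hab : a ≠ b) :
    ∫ z, ‖z a.1 a.2‖ ^ 2 * ‖z b.1 b.2‖ ^ 2 ∂(gaussianField w) = w a.1 a.2 * w b.1 b.2 := by
  have h := ((iIndepFun_eval_gaussianField w).indepFun hab).comp
    (φ := fun x : ℂ => ‖x‖ ^ 2) (ψ := fun x : ℂ => ‖x‖ ^ 2) (by fun_prop) (by fun_prop)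
  rw [← integral_norm_sq_gaussianField w a, ← integral_norm_sq_gaussianField w b]
  exact h.integral_fun_mul_eq_mul_integral
    (Measurable.aestronglyMeasurable (by simp only [Function.comp_def]; fun_prop))
    (Measurable.aestronglyMeasurable (by simp only [Function.comp_def]; fun_prop))

variable [DecidableEq ι]

lemma integral_mul_conj_gaussianField (a b : ι × Fin N) :
    ∫ z, z a.1 a.2 * conj (z b.1 b.2) ∂(gaussianField w) =
      if a = b then ((w a.1 a.2 : ℝ) : ℂ) else 0 := by
  split_ifs with hab
  · subst hab
    rw [← integral_norm_sq_gaussianField w a, ← integral_complex_ofReal]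
    refine integral_congr_ae (ae_of_all _ fun z => ?_)
    simp [Complex.mul_conj, Complex.normSq_eq_norm_sq]
  · refine integral_eq_zero_of_rotate w (fun i n => (i, n) = a)
      (fun z => z a.1 a.2 * conj (z b.1 b.2)) (by fun_prop) Complex.I
      (by simp [Complex.ext_iff]) (fun z => ?_)
    simp [Ne.symm hab, mul_assoc]

/-- Wick's formula for fourth moments: only the pairings of a factor with a conjugated factor
contribute. A monomial without such a pairing picks up a nontrivial factor under the rotation of
one of its coordinates. -/
lemma integral_quartic_gaussianField (a b c d : ι × Fin N) :
    ∫ z, z a.1 a.2 * conj (z b.1 b.2) * (conj (z c.1 c.2) * z d.1 d.2) ∂(gaussianField w) =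
      (if a = b ∧ c = d then ((w a.1 a.2 * w c.1 c.2 : ℝ) : ℂ) else 0) +
        (if a = c ∧ b = d then ((w a.1 a.2 * w b.1 b.2 : ℝ) : ℂ) else 0) := by
  have hf : Measurable fun z : ι → Fin N → ℂ =>
      z a.1 a.2 * conj (z b.1 b.2) * (conj (z c.1 c.2) * z d.1 d.2) := by fun_prop
  have hI : Complex.I ≠ 1 := by simp [Complex.ext_iff]
  have hI' : -Complex.I ≠ 1 := by simp [Complex.ext_iff]
  have hnn : (-1 : ℂ) ≠ 1 := by norm_num
  have hfac {a b : ι × Fin N} (z : ι → Fin N → ℂ) :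
      z a.1 a.2 * conj (z a.1 a.2) * (conj (z b.1 b.2) * z b.1 b.2) =
        ((‖z a.1 a.2‖ ^ 2 * ‖z b.1 b.2‖ ^ 2 : ℝ) : ℂ) := by
    rw [mul_comm (conj (z b.1 b.2)), Complex.mul_conj, Complex.mul_conj,
      Complex.normSq_eq_norm_sq, Complex.normSq_eq_norm_sq]
    push_cast; ring
  by_cases hab : a = b
  · subst hab
    by_cases hcd : c = d
    · subst hcd
      simp_rw [hfac]
      rw [integral_complex_ofReal]
      by_cases hac : a = c
      · subst hac
        have e (z : ι → Fin N → ℂ) : ‖z a.1 a.2‖ ^ 2 * ‖z a.1 a.2‖ ^ 2 = ‖z a.1 a.2‖ ^ 4 := by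
          ring
        simp_rw [e]
        rw [integral_norm_pow_four_gaussianField]
        simp; ring
      · rw [integral_norm_sq_mul_norm_sq_gaussianField w hac]
        simp [hac]
    · rw [integral_eq_zero_of_rotate w (fun i n => (i, n) = c) _ hf (-Complex.I) hI' fun z => ?_]
      · rw [if_neg (by tauto), if_neg, add_zero]
        rintro ⟨rfl, rfl⟩; exact hcd rfl
      · by_cases hac : a = c
        · subst hac
          simp [Ne.symm hcd]
          linear_combination (Complex.I * z a.1 a.2 * conj (z a.1 a.2) *
            (conj (z a.1 a.2) * z d.1 d.2)) * Complex.I_sq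
        · simp [Ne.symm hcd, hac]; ring
  · rw [if_neg (by tauto), zero_add]
    by_cases hac : a = c
    · subst hac
      by_cases hbd : b = d
      · subst hbd
        simp only [and_self, if_true]
        rw [← integral_norm_sq_mul_norm_sq_gaussianField w hab, ← integral_complex_ofReal]
        refine integral_congr_ae (ae_of_all _ fun z => ?_)
        simp only [← hfac]; ring
      · rw [integral_eq_zero_of_rotate w (fun i n => (i, n) = b) _ hf (-Complex.I) hI' fun z => ?_]
        · simp [hbd]
        · simp [hab, Ne.symm hbd]; ring
    · rw [if_neg (by tauto)]
      by_cases had : a = d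
      · subst had
        refine integral_eq_zero_of_rotate w (fun i n => (i, n) = a) _ hf (-1) hnn fun z => ?_
        simp [Ne.symm hab, Ne.symm hac]
        linear_combination (z a.1 a.2 * conj (z b.1 b.2) *
            (conj (z c.1 c.2) * z a.1 a.2)) * Complex.I_sq
      · refine integral_eq_zero_of_rotate w (fun i n => (i, n) = a) _ hf Complex.I hI fun z => ?_
        simp [Ne.symm hab, Ne.symm hac, Ne.symm had]; ring

end GaussianField

/-! ### Integrability of products -/

instance : ENNReal.HolderTriple 4 4 2 := ⟨by
  rw [← two_mul, ← ENNReal.toReal_eq_toReal_iff' (by finiteness) (by finiteness)]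
  norm_num [ENNReal.toReal_mul, ENNReal.toReal_inv]⟩

lemma MeasureTheory.MemLp.conj {Ω : Type*} [MeasurableSpace Ω] {P : Measure Ω}
    {p : ENNReal} {f : Ω → ℂ} (hf : MemLp f p P) : MemLp (fun ω => conj (f ω)) p P :=
  hf.star

lemma integrable_mul_of_memLp_two {Ω : Type*} [MeasurableSpace Ω] {P : Measure Ω}
    {f g : Ω → ℂ} (hf : MemLp f 2 P) (hg : MemLp g 2 P) : Integrable (fun ω => f ω * g ω) P :=
  memLp_one_iff_integrable.1 (hg.mul' hf)

lemma memLp_two_mul_of_memLp_four {Ω : Type*} [MeasurableSpace Ω] {P : Measure Ω}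
    {f g : Ω → ℂ} (hf : MemLp f 4 P) (hg : MemLp g 4 P) : MemLp (fun ω => f ω * g ω) 2 P :=
  hg.mul' hf

namespace Uplink

variable {L K N T B : ℕ} {S : UplinkParams L K N T B}
  {Ω : Type*} [MeasurableSpace Ω] {P : Measure Ω} [IsProbabilityMeasure P] (U : Uplink S P)

/-! ### Laws of channels and noises -/

lemma map_channels (j : Fin L) :
    P.map (fun ω (i : Fin L × Fin K) => U.h j ω i.1 i.2) =
      gaussianField fun i => S.lam j i.1 i.2 := by
  have hm : ∀ l k, Measurable fun ω => U.h j ω l k := fun l k =>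
    (measurable_pi_apply k).comp ((measurable_pi_apply l).comp (U.measurable_h j))
  rw [(iIndepFun_iff_map_fun_eq_pi_map (f := fun (i : Fin L × Fin K) ω => U.h j ω i.1 i.2)
    fun i => (hm i.1 i.2).aemeasurable).1 (U.h_indep j)]
  simp_rw [U.h_law]

lemma measurable_channels (j : Fin L) :
    Measurable (fun ω (i : Fin L × Fin K) => U.h j ω i.1 i.2) := by
  have := U.measurable_h j
  fun_prop

lemma memLp_h (j l : Fin L) (m : Fin K) (n : Fin N) : MemLp (fun ω => U.h j ω l m n) 4 P := by
  have h := memLp_eval_gaussianField (fun i : Fin L × Fin K => S.lam j i.1 i.2) (l, m) n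
  rw [← U.map_channels j] at h
  exact h.comp_of_map (U.measurable_channels j).aemeasurable

lemma memLp_η (j : Fin L) (t : Fin T) (n : Fin N) : MemLp (fun ω => U.η j ω t n) 4 P := by
  have h := memLp_eval_gaussianField (fun _ : Fin T => fun _ : Fin N => S.ξ) t n
  rw [gaussianField, ← U.η_law j] at h
  exact h.comp_of_map (U.measurable_η j).aemeasurable

lemma coe_distortionVar (c : Fin L → Fin K → Fin N → ℂ) (t : Fin T) (n : Fin N) :
    ((distortionVar P S.κ U.x c t n : ℝ≥0) : ℝ) =
      (S.κ : ℝ) ^ 2 * ∑ l, ∑ m, (∫ ω, ‖U.x l m t ω‖ ^ 2 ∂P) * ‖c l m n‖ ^ 2 := by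
  simp only [distortionVar, NNReal.coe_mul, NNReal.coe_pow, NNReal.coe_sum, coe_nnnorm]
  congr 1
  refine Finset.sum_congr rfl fun l _ => Finset.sum_congr rfl fun m _ => ?_
  rw [Real.coe_toNNReal _ (integral_nonneg fun ω => by positivity)]

lemma memLp_norm_sq_h (j l : Fin L) (m : Fin K) (n : Fin N) :
    MemLp (fun ω => ‖U.h j ω l m n‖ ^ 2) 2 P := by
  have h := (U.memLp_h j l m n).norm
  simp_rw [pow_two]
  exact h.mul' h

lemma memLp_distortionVar (j : Fin L) (t : Fin T) (n : Fin N) :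
    MemLp (fun ω => ((distortionVar P S.κ U.x (U.h j ω) t n : ℝ≥0) : ℝ)) 2 P := by
  simp_rw [coe_distortionVar]
  have h (l : Fin L) : MemLp (fun ω => ∑ m, (∫ ω, ‖U.x l m t ω‖ ^ 2 ∂P) * ‖U.h j ω l m n‖ ^ 2)
      2 P := memLp_finsetSum _ fun m _ => (U.memLp_norm_sq_h j l m n).const_mul _
  exact (memLp_finsetSum Finset.univ fun l _ => h l).const_mul ((S.κ : ℝ) ^ 2)

lemma measurable_distortionVar (t : Fin T) (n : Fin N) :
    Measurable fun c : Fin L → Fin K → Fin N → ℂ =>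
      ((distortionVar P S.κ U.x c t n : ℝ≥0) : ℝ) := by
  simp_rw [coe_distortionVar]
  fun_prop

lemma measurable_environment (j : Fin L) : Measurable fun ω => (U.h j ω, U.φ j ω, U.η j ω) :=
  (U.measurable_h j).prodMk ((U.measurable_φ j).prodMk (U.measurable_η j))

lemma memLp_υ (j : Fin L) (t : Fin T) (n : Fin N) : MemLp (fun ω => U.υ j ω t n) 4 P := by
  have hυ : Measurable fun ω => U.υ j ω t n := by
    have := U.measurable_υ j; fun_prop
  have hX := U.measurable_environment j
  rw [← integrable_norm_rpow_iff hυ.aestronglyMeasurable (by simp) (by simp)]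
  simp only [ENNReal.toReal_ofNat]
  norm_cast
  have key : Integrable (fun q : ((Fin L → Fin K → Fin N → ℂ) × (Fin T → Fin N → ℝ) ×
      (Fin T → Fin N → ℂ)) × (Fin T → Fin N → ℂ) => ‖q.2 t n‖ ^ 4)
      (P.map fun ω => ((U.h j ω, U.φ j ω, U.η j ω), U.υ j ω)) := by
    rw [← compProd_map_condDistrib (U.measurable_υ j).aemeasurable,
      Measure.integrable_compProd_iff (by fun_prop)]
    have hlaw := U.υ_law j
    refine ⟨?_, ?_⟩
    · filter_upwards [hlaw] with c hc
      rw [hc]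
      exact (memLp_eval_gaussianField (distortionVar P S.κ U.x c.1) t n).integrable_norm_pow'
    · have : (fun c => ∫ y, ‖‖y t n‖ ^ 4‖ ∂(condDistrib (U.υ j)
          (fun ω => (U.h j ω, U.φ j ω, U.η j ω)) P c)) =ᵐ[P.map fun ω =>
            (U.h j ω, U.φ j ω, U.η j ω)]
          fun c => 2 * ((distortionVar P S.κ U.x c.1 t n : ℝ≥0) : ℝ) ^ 2 := by
        filter_upwards [hlaw] with c hc
        rw [hc]
        simp only [norm_pow, norm_norm]
        exact integral_norm_pow_four_gaussianField (distortionVar P S.κ U.x c.1) (t, n)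
      rw [integrable_congr this, integrable_map_measure _ hX.aemeasurable]
      · exact (U.memLp_distortionVar j t n).integrable_sq.const_mul 2
      · exact ((((U.measurable_distortionVar t n).comp measurable_fst).pow_const 2).const_mul
          2).aestronglyMeasurable
  have h := (integrable_map_measure (Measurable.aestronglyMeasurable (by fun_prop))
    (hX.prodMk (U.measurable_υ j)).aemeasurable).1 key
  exact h

lemma indepFun_channels_phases (j : Fin L) : IndepFun (U.h j) (U.φ j) P :=
  (U.h_φ_η_indep j).comp measurable_id measurable_fst

lemma indepFun_channels_phases_noise (j : Fin L) :
    IndepFun (fun ω => (U.h j ω, U.φ j ω)) (U.η j) P := by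
  have h1 := U.measurable_h j
  have h2 := U.measurable_φ j
  have h3 := U.measurable_η j
  have e := (indepFun_iff_map_prod_eq_prod_map_map h1.aemeasurable
    (h2.prodMk h3).aemeasurable).1 (U.h_φ_η_indep j)
  rw [(indepFun_iff_map_prod_eq_prod_map_map h2.aemeasurable h3.aemeasurable).1
    (U.φ_η_indep j)] at e
  have := Measure.isProbabilityMeasure_map (μ := P) h1.aemeasurable
  have := Measure.isProbabilityMeasure_map (μ := P) h2.aemeasurable
  have := Measure.isProbabilityMeasure_map (μ := P) h3.aemeasurable
  rw [indepFun_iff_map_prod_eq_prod_map_map (h1.prodMk h2).aemeasurable h3.aemeasurable,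
    (indepFun_iff_map_prod_eq_prod_map_map h1.aemeasurable h2.aemeasurable).1
    (U.indepFun_channels_phases j)]
  apply MeasurableEquiv.prodAssoc.map_measurableEquiv_injective
  rw [Measure.prodAssoc_prod, ← e, Measure.map_map (by fun_prop) (by fun_prop)]
  rfl

/-- Integrals factor along channels and phases, receiver noise, and distortion noise, where the
distortion noise is integrated out conditionally on the channels `c`; the result is `k c`. -/
lemma integral_environment_mul (j : Fin L)
    {F : (Fin L → Fin K → Fin N → ℂ) → (Fin T → Fin N → ℝ) → ℂ}
    {G J : (Fin T → Fin N → ℂ) → ℂ} {k : (Fin L → Fin K → Fin N → ℂ) → ℂ}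
    (hF : Measurable F.uncurry) (hG : Measurable G) (hJ : Measurable J) (hk : Measurable k)
    (hint : Integrable (fun ω => F (U.h j ω) (U.φ j ω) * G (U.η j ω) * J (U.υ j ω)) P)
    (hJk : ∀ c, ∫ z, J z ∂(gaussianField (distortionVar P S.κ U.x c)) = k c) :
    ∫ ω, F (U.h j ω) (U.φ j ω) * G (U.η j ω) * J (U.υ j ω) ∂P =
      (∫ ω, F (U.h j ω) (U.φ j ω) * k (U.h j ω) ∂P) * ∫ ω, G (U.η j ω) ∂P := by
  have hX := U.measurable_environment j
  have hXY := hX.prodMk (U.measurable_υ j)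
  set f : ((Fin L → Fin K → Fin N → ℂ) × (Fin T → Fin N → ℝ) ×
      (Fin T → Fin N → ℂ)) × (Fin T → Fin N → ℂ) → ℂ :=
    fun q => F q.1.1 q.1.2.1 * G q.1.2.2 * J q.2 with hf
  have hFm : Measurable fun q : (Fin L → Fin K → Fin N → ℂ) × (Fin T → Fin N → ℝ) ×
      (Fin T → Fin N → ℂ) => F q.1 q.2.1 :=
    hF.comp (measurable_fst.prodMk (measurable_fst.comp measurable_snd))
  have hfm : Measurable f :=
    ((hFm.comp measurable_fst).mul (hG.comp (by fun_prop))).mul (hJ.comp measurable_snd)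
  have hfint : Integrable f (P.map fun ω => ((U.h j ω, U.φ j ω, U.η j ω), U.υ j ω)) :=
    (integrable_map_measure hfm.aestronglyMeasurable hXY.aemeasurable).2 hint
  have e1 : ∫ ω, F (U.h j ω) (U.φ j ω) * G (U.η j ω) * J (U.υ j ω) ∂P =
      ∫ q, f q ∂(P.map fun ω => ((U.h j ω, U.φ j ω, U.η j ω), U.υ j ω)) :=
    (integral_map hXY.aemeasurable hfm.aestronglyMeasurable).symm
  rw [← compProd_map_condDistrib (U.measurable_υ j).aemeasurable] at hfint e1
  rw [e1, Measure.integral_compProd hfint]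
  have e2 : ∫ a, ∫ b, f (a, b) ∂(condDistrib (U.υ j) (fun ω => (U.h j ω, U.φ j ω, U.η j ω)) P a)
      ∂(P.map fun ω => (U.h j ω, U.φ j ω, U.η j ω)) =
      ∫ a, F a.1 a.2.1 * G a.2.2 * k a.1 ∂(P.map fun ω => (U.h j ω, U.φ j ω, U.η j ω)) := by
    refine integral_congr_ae ?_
    filter_upwards [U.υ_law j] with a ha
    rw [ha, ← hJk a.1]
    simp only [hf]
    rw [integral_const_mul]
  have hm : Measurable fun a : (Fin L → Fin K → Fin N → ℂ) × (Fin T → Fin N → ℝ) ×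
      (Fin T → Fin N → ℂ) => F a.1 a.2.1 * G a.2.2 * k a.1 :=
    (hFm.mul (hG.comp (by fun_prop))).mul (hk.comp measurable_fst)
  rw [e2, integral_map hX.aemeasurable hm.aestronglyMeasurable]
  have hFk : Measurable fun q : (Fin L → Fin K → Fin N → ℂ) × (Fin T → Fin N → ℝ) =>
      F q.1 q.2 * k q.1 := hF.mul (hk.comp measurable_fst)
  have hind := (U.indepFun_channels_phases_noise j).comp hFk hG
  have hm1 : Measurable fun ω => F (U.h j ω) (U.φ j ω) * k (U.h j ω) :=
    hFk.comp ((U.measurable_h j).prodMk (U.measurable_φ j))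
  have e3 := hind.integral_fun_mul_eq_mul_integral hm1.aestronglyMeasurable
    (hG.comp (U.measurable_η j)).aestronglyMeasurable
  simp only [Function.comp_apply] at e3
  refine Eq.trans (integral_congr_ae (ae_of_all _ fun ω => ?_)) e3
  simp only; ring

lemma integral_channels_mul_phases (j : Fin L) {F : (Fin L → Fin K → Fin N → ℂ) → ℂ}
    {G : (Fin T → Fin N → ℝ) → ℂ} (hF : Measurable F) (hG : Measurable G) :
    ∫ ω, F (U.h j ω) * G (U.φ j ω) ∂P = (∫ ω, F (U.h j ω) ∂P) * ∫ ω, G (U.φ j ω) ∂P :=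
  ((U.indepFun_channels_phases j).comp hF hG).integral_fun_mul_eq_mul_integral
    (hF.comp (U.measurable_h j)).aestronglyMeasurable
    (hG.comp (U.measurable_φ j)).aestronglyMeasurable

/-! ### Moments of channels, receiver noise and phase drifts -/

lemma integral_channels (j : Fin L) {f : (Fin L × Fin K → Fin N → ℂ) → ℂ} (hf : Measurable f) :
    ∫ ω, f (fun i => U.h j ω i.1 i.2) ∂P =
      ∫ z, f z ∂(gaussianField fun i : Fin L × Fin K => S.lam j i.1 i.2) := by
  rw [← U.map_channels j, integral_map (U.measurable_channels j).aemeasurable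
    hf.aestronglyMeasurable]

lemma integral_noise (j : Fin L) {f : (Fin T → Fin N → ℂ) → ℂ} (hf : Measurable f) :
    ∫ ω, f (U.η j ω) ∂P = ∫ z, f z ∂(gaussianField fun (_ : Fin T) (_ : Fin N) => S.ξ) := by
  rw [gaussianField, ← U.η_law j, integral_map (U.measurable_η j).aemeasurable
    hf.aestronglyMeasurable]

/-- The phase rotation `e^{ı φ_{jn}(t)}`. -/
noncomputable def cis (j : Fin L) (t : Fin T) (n : Fin N) (ω : Ω) : ℂ :=
  Complex.exp (Complex.I * (U.φ j ω t n : ℂ))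

lemma measurable_cis (j : Fin L) (t : Fin T) (n : Fin N) : Measurable (U.cis j t n) := by
  have := U.measurable_φ j
  unfold cis
  fun_prop

lemma cis_mul_conj (j : Fin L) (s t : Fin T) (n : Fin N) (ω : Ω) :
    U.cis j s n ω * conj (U.cis j t n ω) =
      Complex.exp (Complex.I * ((U.φ j ω s n - U.φ j ω t n : ℝ) : ℂ)) := by
  rw [cis, cis, ← Complex.exp_conj, ← Complex.exp_add]
  congr 1
  simp
  ring

@[simp]
lemma norm_cis (j : Fin L) (t : Fin T) (n : Fin N) (ω : Ω) : ‖U.cis j t n ω‖ = 1 := by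
  rw [cis, mul_comm, Complex.norm_exp_ofReal_mul_I]

lemma cis_mul_conj_self (j : Fin L) (t : Fin T) (n : Fin N) (ω : Ω) :
    U.cis j t n ω * conj (U.cis j t n ω) = 1 := by
  simp [cis_mul_conj]

/-- The innovations multiply independent factors `e^{-δ/2}`. -/
lemma integral_cis_mul_conj_of_add (j : Fin L) (n : Fin N) (d : ℕ) :
    ∀ s t : Fin T, (t : ℕ) = s + d →
      ∫ ω, U.cis j t n ω * conj (U.cis j s n ω) ∂P =
        (Real.exp (-((S.δ : ℝ) / 2) * d) : ℂ) := by
  induction d with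
  | zero =>
    intro s t h
    obtain rfl : t = s := Fin.ext (by simpa using h)
    simp [cis_mul_conj_self]
  | succ d ih =>
    intro s t h
    have hu : (s : ℕ) + d < T := by have := t.2; omega
    set u : Fin T := ⟨s + d, hu⟩ with hud
    have hsu : s ≤ u := by rw [Fin.le_def]; simp [hud]
    have htu : (t : ℕ) = u + 1 := by rw [h, hud]; ring
    have hmφ := U.measurable_φ j
    have hsplit (ω : Ω) : U.cis j t n ω * conj (U.cis j s n ω) =
        Complex.exp (Complex.I * ((U.φ j ω t n - U.φ j ω u n : ℝ) : ℂ)) *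
          (U.cis j u n ω * conj (U.cis j s n ω)) := by
      rw [cis_mul_conj, cis_mul_conj, ← Complex.exp_add]
      congr 1; push_cast; ring
    have hind := (U.φ_indep j n u t htu).comp
      (φ := fun x : ℝ => Complex.exp (Complex.I * (x : ℂ)))
      (ψ := fun y : Set.Iic u → ℝ =>
        Complex.exp (Complex.I * ((y ⟨u, le_refl u⟩ - y ⟨s, hsu⟩ : ℝ) : ℂ)))
      (by fun_prop) (by fun_prop)
    have e := hind.integral_fun_mul_eq_mul_integral
      (Measurable.aestronglyMeasurable (by simp only [Function.comp_def]; fun_prop))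
      (Measurable.aestronglyMeasurable (by simp only [Function.comp_def]; fun_prop))
    simp only [Function.comp_apply, ← U.cis_mul_conj j u s n] at e
    simp_rw [hsplit]
    have hih := ih s u (by simp [hud])
    have hgauss : ∫ ω, Complex.exp (Complex.I * ((U.φ j ω t n - U.φ j ω u n : ℝ) : ℂ)) ∂P =
        Complex.exp (-((S.δ : ℝ) : ℂ) / 2) := by
      have h1 := charFun_gaussianReal (μ := 0) (v := S.δ) 1
      rw [← U.φ_law j n u t htu, charFun_apply_real,
        integral_map (Measurable.aemeasurable (by fun_prop)) (by fun_prop)] at h1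
      convert h1 using 1
      · refine integral_congr_ae (ae_of_all _ fun ω => ?_)
        simp only; congr 1; push_cast; ring
      · congr 1; push_cast; ring
    rw [e, hih, hgauss]
    push_cast
    rw [← Complex.exp_add]
    congr 1; ring

lemma integral_cis_mul_conj (j : Fin L) (n : Fin N) (s t : Fin T) :
    ∫ ω, U.cis j s n ω * conj (U.cis j t n ω) ∂P = (S.decay s t : ℂ) := by
  rcases le_total t s with h | h
  · obtain ⟨d, hd⟩ := Nat.exists_eq_add_of_le (Fin.le_def.1 h)
    rw [U.integral_cis_mul_conj_of_add j n d t s hd, UplinkParams.decay, hd]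
    simp
  · obtain ⟨d, hd⟩ := Nat.exists_eq_add_of_le (Fin.le_def.1 h)
    have e := congrArg conj (U.integral_cis_mul_conj_of_add j n d s t hd)
    rw [← integral_conj, Complex.conj_ofReal] at e
    simp only [map_mul, Complex.conj_conj] at e
    simp_rw [mul_comm (U.cis j s n _), e, UplinkParams.decay, hd]
    simp

end Uplink

lemma integrable_mul_conj_mul {Ω : Type*} [MeasurableSpace Ω] {P : Measure Ω} {f g w : Ω → ℂ}
    (hf : MemLp f 4 P) (hg : MemLp g 4 P) (hw : MemLp w 2 P) :
    Integrable (fun ω => f ω * conj (g ω) * w ω) P :=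
  integrable_mul_of_memLp_two (memLp_two_mul_of_memLp_four hf hg.conj) hw

/-- Sesquilinear expansion of a weighted second moment. -/
lemma integral_sum_mul_conj_sum_mul {Ω ι κ : Type*} [MeasurableSpace Ω] {P : Measure Ω}
    [Fintype ι] [Fintype κ] {f : ι → Ω → ℂ} {g : κ → Ω → ℂ} {w : Ω → ℂ}
    (h : ∀ i i', Integrable (fun ω => f i ω * conj (g i' ω) * w ω) P) :
    ∫ ω, (∑ i, f i ω) * conj (∑ i, g i ω) * w ω ∂P =
      ∑ i, ∑ i', ∫ ω, f i ω * conj (g i' ω) * w ω ∂P := by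
  simp_rw [map_sum, Finset.sum_mul_sum, Finset.sum_mul]
  rw [integral_finsetSum _ fun i _ => integrable_finsetSum _ fun i' _ => h i i']
  exact Finset.sum_congr rfl fun i _ => integral_finsetSum _ fun i' _ => h i i'

namespace UplinkParams

variable {L K N T B : ℕ} (S : UplinkParams L K N T B)

/-- The noise-free part of the pilot signal, as a function of channels `c` and phases `f`. -/
noncomputable def signal (c : Fin L → Fin K → Fin N → ℂ) (f : Fin T → Fin N → ℝ)
    (p : Fin B × Fin N) : ℂ :=
  Complex.exp (Complex.I * (f (S.τ p.1) p.2 : ℂ)) *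
    ∑ i : Fin L × Fin K, S.pilot i.1 i.2 p.1 * c i.1 i.2 p.2

lemma measurable_signal (p : Fin B × Fin N) :
    Measurable fun q : (Fin L → Fin K → Fin N → ℂ) × (Fin T → Fin N → ℝ) =>
      S.signal q.1 q.2 p := by
  unfold signal
  fun_prop

lemma Xbar_apply (l : Fin L) (m : Fin K) (b₁ b₂ : Fin B) :
    S.Xbar l m b₁ b₂ =
      S.pilot l m b₁ * conj (S.pilot l m b₂) * (S.decay (S.τ b₁) (S.τ b₂) : ℂ) := by
  rw [Xbar, Matrix.of_apply]
  split_ifs with h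
  · subst h
    simp [decay, Complex.mul_conj, Complex.normSq_eq_norm_sq]
  · rfl

lemma X_apply (l : Fin L) (m : Fin K) (b₁ b₂ : Fin B) :
    S.X l m b₁ b₂ =
      S.pilot l m b₁ * conj (S.pilot l m b₂) * (S.decay (S.τ b₁) (S.τ b₂) : ℂ) +
        if b₁ = b₂ then ((S.κ : ℝ) : ℂ) ^ 2 * ((‖S.pilot l m b₁‖ ^ 2 : ℝ) : ℂ) else 0 := by
  rw [X, Matrix.add_apply, Xbar_apply, Matrix.smul_apply, Dsq, Matrix.diagonal_apply]
  split_ifs <;> simp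

lemma Psi_apply (j : Fin L) (p q : Fin B × Fin N) :
    S.Psi j p q = (if p.2 = q.2 then ∑ l, ∑ m, S.X l m p.1 q.1 * ((S.lam j l m p.2 : ℝ) : ℂ) else 0)
      + if p = q then ((S.ξ : ℝ) : ℂ) else 0 := by
  rw [Psi, Matrix.add_apply, Matrix.smul_apply, Matrix.one_apply]
  simp only [Matrix.sum_apply, Matrix.kroneckerMap_apply, Lam, Matrix.diagonal_apply]
  congr 1
  · split_ifs <;> simp
  · split_ifs <;> simp

lemma xRow_apply (l : Fin L) (k : Fin K) (t : Fin T) (b : Fin B) :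
    S.xRow l k t b = conj (S.pilot l k b) * (S.decay t (S.τ b) : ℂ) := by
  simp [xRow, Dδ, Matrix.vecMul_diagonal]

lemma xCol_apply (l : Fin L) (k : Fin K) (t : Fin T) (b : Fin B) :
    S.xCol l k t b = (S.decay t (S.τ b) : ℂ) * S.pilot l k b := by
  simp [xCol, Dδ, Matrix.diagonal_conjTranspose, Matrix.mulVec_diagonal]

end UplinkParams

namespace Uplink

variable {L K N T B : ℕ} {S : UplinkParams L K N T B}
  {Ω : Type*} [MeasurableSpace Ω] {P : Measure Ω} [IsProbabilityMeasure P] (U : Uplink S P)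

/-! ### Second moments of the pilot signal under a weight -/

lemma memLp_cis_mul {p : ENNReal} (j : Fin L) (t : Fin T) (n : Fin N) {f : Ω → ℂ}
    (hf : MemLp f p P) : MemLp (fun ω => U.cis j t n ω * f ω) p P :=
  hf.of_le ((U.measurable_cis j t n).aestronglyMeasurable.mul hf.1)
    (ae_of_all _ fun ω => by simp)

lemma effChannel_apply (j l : Fin L) (m : Fin K) (t : Fin T) (ω : Ω) (n : Fin N) :
    U.effChannel j l m t ω n = U.cis j t n ω * U.h j ω l m n := by
  simp [effChannel, cis, Matrix.mulVec_diagonal]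

lemma memLp_effChannel (j l : Fin L) (m : Fin K) (t : Fin T) (n : Fin N) :
    MemLp (fun ω => U.effChannel j l m t ω n) 4 P := by
  simp_rw [effChannel_apply]
  exact U.memLp_cis_mul j t n (U.memLp_h j l m n)

lemma signal_eq (j : Fin L) (ω : Ω) (p : Fin B × Fin N) :
    S.signal (U.h j ω) (U.φ j ω) p = U.cis j (S.τ p.1) p.2 ω *
      ∑ i : Fin L × Fin K, S.pilot i.1 i.2 p.1 * U.h j ω i.1 i.2 p.2 := rfl

lemma memLp_signal (j : Fin L) (p : Fin B × Fin N) :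
    MemLp (fun ω => S.signal (U.h j ω) (U.φ j ω) p) 4 P := by
  simp_rw [signal_eq]
  exact U.memLp_cis_mul j _ _ (memLp_finsetSum _ fun i _ => (U.memLp_h j i.1 i.2 p.2).const_mul _)

lemma pilotSignal_apply (j : Fin L) (ω : Ω) (p : Fin B × Fin N) :
    U.pilotSignal j ω p = S.signal (U.h j ω) (U.φ j ω) p + U.υ j ω (S.τ p.1) p.2 +
      U.η j ω (S.τ p.1) p.2 := by
  simp [pilotSignal, received, signal_eq, cis, Matrix.mulVec_diagonal, Finset.sum_apply,
    U.x_pilot, Fintype.sum_prod_type]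

lemma memLp_pilotSignal (j : Fin L) (p : Fin B × Fin N) :
    MemLp (fun ω => U.pilotSignal j ω p) 4 P := by
  simp_rw [pilotSignal_apply]
  exact ((U.memLp_signal j p).add (U.memLp_υ j _ _)).add (U.memLp_η j _ _)

/-- A second moment of the pilot signal, weighted by `F(h, φ) J(υ)`. Only the pairings
signal–signal, distortion–distortion and noise–noise survive. The weight `J` has to have conditional
mean `k` and to be conditionally uncorrelated with the distortion at the pilot times. -/
lemma integral_pilotSignal_mul_conj_mul (j : Fin L) (p q : Fin B × Fin N)
    {F : (Fin L → Fin K → Fin N → ℂ) → (Fin T → Fin N → ℝ) → ℂ}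
    {J : (Fin T → Fin N → ℂ) → ℂ} {k : (Fin L → Fin K → Fin N → ℂ) → ℂ}
    (hF : Measurable F.uncurry) (hJ : Measurable J) (hk : Measurable k)
    (hFJ : MemLp (fun ω => F (U.h j ω) (U.φ j ω) * J (U.υ j ω)) 2 P)
    (hJ0 : ∀ c, ∫ z, J z ∂(gaussianField (distortionVar P S.κ U.x c)) = k c)
    (hJ1 : ∀ c, ∫ z, z (S.τ p.1) p.2 * J z ∂(gaussianField (distortionVar P S.κ U.x c)) = 0)
    (hJ2 : ∀ c, ∫ z, conj (z (S.τ q.1) q.2) * J z ∂(gaussianField (distortionVar P S.κ U.x c)) = 0)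
    (hJ3 : ∀ c, ∫ z, z (S.τ p.1) p.2 * conj (z (S.τ q.1) q.2) * J z
      ∂(gaussianField (distortionVar P S.κ U.x c)) =
        if p = q then ((distortionVar P S.κ U.x c (S.τ p.1) p.2 : ℝ) : ℂ) * k c else 0) :
    ∫ ω, U.pilotSignal j ω p * conj (U.pilotSignal j ω q) *
        (F (U.h j ω) (U.φ j ω) * J (U.υ j ω)) ∂P =
      ∫ ω, S.signal (U.h j ω) (U.φ j ω) p * conj (S.signal (U.h j ω) (U.φ j ω) q) *
          (F (U.h j ω) (U.φ j ω) * k (U.h j ω)) ∂P +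
        if p = q then
          ∫ ω, ((distortionVar P S.κ U.x (U.h j ω) (S.τ p.1) p.2 : ℝ) : ℂ) *
            (F (U.h j ω) (U.φ j ω) * k (U.h j ω)) ∂P +
          ((S.ξ : ℝ) : ℂ) * ∫ ω, F (U.h j ω) (U.φ j ω) * k (U.h j ω) ∂P
        else 0 := by
  have hS := U.memLp_signal j
  have hυ := U.memLp_υ j
  have hη := U.memLp_η j
  have hsp := S.measurable_signal p
  have hsq : Measurable fun r : (Fin L → Fin K → Fin N → ℂ) × (Fin T → Fin N → ℝ) =>
      conj (S.signal r.1 r.2 q) := Complex.continuous_conj.measurable.comp (S.measurable_signal q)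
  -- each of the nine products splits into a factor of each kind
  have key {A : (Fin L → Fin K → Fin N → ℂ) → (Fin T → Fin N → ℝ) → ℂ}
      {G J' : (Fin T → Fin N → ℂ) → ℂ} {k' : (Fin L → Fin K → Fin N → ℂ) → ℂ} {f g : Ω → ℂ}
      (hA : Measurable A.uncurry) (hG : Measurable G) (hJ' : Measurable J') (hk' : Measurable k')
      (hf : MemLp f 4 P) (hg : MemLp g 4 P)
      (hfg : ∀ ω, f ω * conj (g ω) = A (U.h j ω) (U.φ j ω) * G (U.η j ω) * J' (U.υ j ω))
      (hk : ∀ c, ∫ z, J' z * J z ∂(gaussianField (distortionVar P S.κ U.x c)) = k' c) :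
      ∫ ω, f ω * conj (g ω) * (F (U.h j ω) (U.φ j ω) * J (U.υ j ω)) ∂P =
        (∫ ω, A (U.h j ω) (U.φ j ω) * F (U.h j ω) (U.φ j ω) * k' (U.h j ω) ∂P) *
          ∫ ω, G (U.η j ω) ∂P := by
    have e (ω : Ω) : f ω * conj (g ω) * (F (U.h j ω) (U.φ j ω) * J (U.υ j ω)) =
        (A (U.h j ω) (U.φ j ω) * F (U.h j ω) (U.φ j ω)) * G (U.η j ω) *
          (J' (U.υ j ω) * J (U.υ j ω)) := by
      rw [hfg]; ring
    have hint := integrable_mul_conj_mul hf hg hFJ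
    simp_rw [e] at hint ⊢
    exact U.integral_environment_mul j (F := fun c f => A c f * F c f) (hA.mul hF) hG
      (hJ'.mul hJ) hk' hint hk
  have h0 : Measurable fun _ : Fin L → Fin K → Fin N → ℂ => (0 : ℂ) := measurable_const
  have h1 : Measurable (Function.uncurry
      fun (_ : Fin L → Fin K → Fin N → ℂ) (_ : Fin T → Fin N → ℝ) => (1 : ℂ)) := measurable_const
  have h1' : Measurable fun _ : Fin T → Fin N → ℂ => (1 : ℂ) := measurable_const
  have hkv : Measurable fun c => if p = q then
      ((distortionVar P S.κ U.x c (S.τ p.1) p.2 : ℝ) : ℂ) * k c else 0 := by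
    split_ifs
    · exact (Complex.measurable_ofReal.comp (U.measurable_distortionVar _ _)).mul hk
    · exact h0
  -- moments of the receiver noise
  have hη1 : ∫ ω, U.η j ω (S.τ p.1) p.2 ∂P = 0 :=
    (U.integral_noise j (f := fun z => z (S.τ p.1) p.2) (by fun_prop)).trans
      (integral_eval_gaussianField _ _ _)
  have hη2 : ∫ ω, conj (U.η j ω (S.τ q.1) q.2) ∂P = 0 :=
    (U.integral_noise j (f := fun z => conj (z (S.τ q.1) q.2)) (by fun_prop)).trans
      (integral_conj_gaussianField _ _ _)
  have hη3 : ∫ ω, U.η j ω (S.τ p.1) p.2 * conj (U.η j ω (S.τ q.1) q.2) ∂P =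
      if p = q then ((S.ξ : ℝ) : ℂ) else 0 := by
    refine (U.integral_noise j (f := fun z => z (S.τ p.1) p.2 * conj (z (S.τ q.1) q.2))
      (by fun_prop)).trans ?_
    refine (integral_mul_conj_gaussianField _ (S.τ p.1, p.2) (S.τ q.1, q.2)).trans ?_
    simp [Prod.ext_iff, S.τ_injective.eq_iff]
  have ss := key (A := fun c f => S.signal c f p * conj (S.signal c f q)) (G := fun _ => 1)
    (J' := fun _ => 1) (hsp.mul hsq) h1' h1' hk (hS p) (hS q)
    (fun ω => by ring) (by simpa using hJ0)
  have sv := key (A := fun c f => S.signal c f p) (G := fun _ => 1)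
    (J' := fun z => conj (z (S.τ q.1) q.2)) (k' := fun _ => 0) hsp h1' (by fun_prop) h0
    (hS p) (hυ (S.τ q.1) q.2) (fun ω => by ring) hJ2
  have sn := key (A := fun c f => S.signal c f p) (G := fun z => conj (z (S.τ q.1) q.2))
    (J' := fun _ => 1) (k' := k) hsp (by fun_prop) h1' hk
    (hS p) (hη (S.τ q.1) q.2) (fun ω => by ring) (by simpa using hJ0)
  have vs := key (A := fun c f => conj (S.signal c f q)) (G := fun _ => 1)
    (J' := fun z => z (S.τ p.1) p.2) (k' := fun _ => 0) hsq h1' (by fun_prop) h0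
    (hυ (S.τ p.1) p.2) (hS q) (fun ω => by ring) hJ1
  have vv := key (A := fun _ _ => 1) (G := fun _ => 1)
    (J' := fun z => z (S.τ p.1) p.2 * conj (z (S.τ q.1) q.2)) h1 h1' (by fun_prop) hkv
    (hυ (S.τ p.1) p.2) (hυ (S.τ q.1) q.2) (fun ω => by ring) hJ3
  have vn := key (A := fun _ _ => 1) (G := fun z => conj (z (S.τ q.1) q.2))
    (J' := fun z => z (S.τ p.1) p.2) (k' := fun _ => 0) h1 (by fun_prop) (by fun_prop) h0
    (hυ (S.τ p.1) p.2) (hη (S.τ q.1) q.2) (fun ω => by ring) hJ1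
  have ns := key (A := fun c f => conj (S.signal c f q)) (G := fun z => z (S.τ p.1) p.2)
    (J' := fun _ => 1) (k' := k) hsq (by fun_prop) h1' hk
    (hη (S.τ p.1) p.2) (hS q) (fun ω => by ring) (by simpa using hJ0)
  have nv := key (A := fun _ _ => 1) (G := fun z => z (S.τ p.1) p.2)
    (J' := fun z => conj (z (S.τ q.1) q.2)) (k' := fun _ => 0) h1 (by fun_prop) (by fun_prop) h0
    (hη (S.τ p.1) p.2) (hυ (S.τ q.1) q.2) (fun ω => by ring) hJ2
  have nn := key (A := fun _ _ => 1) (G := fun z => z (S.τ p.1) p.2 * conj (z (S.τ q.1) q.2))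
    (J' := fun _ => 1) h1 (by fun_prop) h1' hk
    (hη (S.τ p.1) p.2) (hη (S.τ q.1) q.2) (fun ω => by ring) (by simpa using hJ0)
  have hsum := integral_sum_mul_conj_sum_mul (P := P)
    (f := ![fun ω => S.signal (U.h j ω) (U.φ j ω) p, fun ω => U.υ j ω (S.τ p.1) p.2,
      fun ω => U.η j ω (S.τ p.1) p.2])
    (g := ![fun ω => S.signal (U.h j ω) (U.φ j ω) q, fun ω => U.υ j ω (S.τ q.1) q.2,
      fun ω => U.η j ω (S.τ q.1) q.2]) (w := fun ω => F (U.h j ω) (U.φ j ω) * J (U.υ j ω))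
    (fun i i' => by
      refine integrable_mul_conj_mul ?_ ?_ hFJ
      · fin_cases i
        exacts [hS p, hυ _ _, hη _ _]
      · fin_cases i'
        exacts [hS q, hυ _ _, hη _ _])
  simp only [Fin.sum_univ_three, Matrix.cons_val] at hsum
  simp_rw [pilotSignal_apply]
  rw [hsum, ss, sv, sn, vs, vv, vn, ns, nv, nn, hη1, hη2, hη3]
  split_ifs with h
  · simp only [integral_const, probReal_univ, one_smul, mul_one, mul_zero, one_mul, add_zero,
      zero_add, mul_assoc]
    have e (ω : Ω) : F (U.h j ω) (U.φ j ω) *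
        (((distortionVar P S.κ U.x (U.h j ω) (S.τ p.1) p.2 : ℝ) : ℂ) * k (U.h j ω)) =
        ((distortionVar P S.κ U.x (U.h j ω) (S.τ p.1) p.2 : ℝ) : ℂ) *
          (F (U.h j ω) (U.φ j ω) * k (U.h j ω)) := by ring
    simp_rw [e]
    ring
  · simp [mul_assoc]

/-- The weight depends only on channels and phases. -/
lemma integral_pilotSignal_mul_conj_mul' (j : Fin L) (p q : Fin B × Fin N)
    {F : (Fin L → Fin K → Fin N → ℂ) → (Fin T → Fin N → ℝ) → ℂ}
    (hF : Measurable F.uncurry) (hF2 : MemLp (fun ω => F (U.h j ω) (U.φ j ω)) 2 P) :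
    ∫ ω, U.pilotSignal j ω p * conj (U.pilotSignal j ω q) * F (U.h j ω) (U.φ j ω) ∂P =
      ∫ ω, S.signal (U.h j ω) (U.φ j ω) p * conj (S.signal (U.h j ω) (U.φ j ω) q) *
          F (U.h j ω) (U.φ j ω) ∂P +
        if p = q then
          ∫ ω, ((distortionVar P S.κ U.x (U.h j ω) (S.τ p.1) p.2 : ℝ) : ℂ) *
            F (U.h j ω) (U.φ j ω) ∂P + ((S.ξ : ℝ) : ℂ) * ∫ ω, F (U.h j ω) (U.φ j ω) ∂P
        else 0 := by
  have h := U.integral_pilotSignal_mul_conj_mul j p q (F := F) (J := fun _ => 1) (k := fun _ => 1)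
    hF measurable_const measurable_const (by simpa using hF2) (by simp)
    (fun c => by simpa using integral_eval_gaussianField _ _ _)
    (fun c => by simpa using integral_conj_gaussianField _ _ _)
    (fun c => by
      simp only [mul_one]
      refine (integral_mul_conj_gaussianField _ (S.τ p.1, p.2) (S.τ q.1, q.2)).trans ?_
      simp [Prod.ext_iff, S.τ_injective.eq_iff])
  simpa only [mul_one] using h

/-- At a data time `t`, the distortion noise enters fourth moments with the pilot signal only through
its conditional variance. -/
lemma integral_pilotSignal_mul_conj_mul_distortion (j : Fin L) (p q : Fin B × Fin N) {t : Fin T}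
    (ht : t ∈ S.dataTimes) (n₁ n₂ : Fin N) :
    ∫ ω, U.pilotSignal j ω p * conj (U.pilotSignal j ω q) *
        (conj (U.υ j ω t n₁) * U.υ j ω t n₂) ∂P =
      if n₁ = n₂ then ∫ ω, U.pilotSignal j ω p * conj (U.pilotSignal j ω q) *
        ((distortionVar P S.κ U.x (U.h j ω) t n₁ : ℝ) : ℂ) ∂P else 0 := by
  have hτ (b : Fin B) : S.τ b ≠ t := fun h => ht ⟨b, h⟩
  have hvm := Complex.measurable_ofReal.comp (U.measurable_distortionVar t n₁)
  have hv2 : MemLp (fun ω => ((distortionVar P S.κ U.x (U.h j ω) t n₁ : ℝ) : ℂ)) 2 P :=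
    (U.memLp_distortionVar j t n₁).ofReal
  have h := U.integral_pilotSignal_mul_conj_mul j p q (F := fun _ _ => 1)
    (J := fun z => conj (z t n₁) * z t n₂)
    (k := fun c => if n₁ = n₂ then ((distortionVar P S.κ U.x c t n₁ : ℝ) : ℂ) else 0)
    measurable_const (by fun_prop)
    (by split_ifs; exacts [hvm, measurable_const])
    (by
      simp only [one_mul]
      exact memLp_two_mul_of_memLp_four (U.memLp_υ j t n₁).conj (U.memLp_υ j t n₂))
    (fun c => by
      simp_rw [mul_comm (conj _)]
      refine (integral_mul_conj_gaussianField _ (t, n₂) (t, n₁)).trans ?_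
      by_cases hn : n₁ = n₂
      · simp [hn]
      · simp [hn, Ne.symm hn])
    (fun c => integral_cubic_gaussianField _ (S.τ p.1, p.2) (t, n₁) (t, n₂))
    (fun c => integral_conj_cubic_gaussianField _ (S.τ q.1, q.2) (t, n₁) (t, n₂))
    (fun c => by
      refine (integral_quartic_gaussianField _ (S.τ p.1, p.2) (S.τ q.1, q.2) (t, n₁)
        (t, n₂)).trans ?_
      simp only [Prod.ext_iff, S.τ_injective.eq_iff, hτ, true_and, false_and, if_false, add_zero]
      by_cases h1 : p.1 = q.1 ∧ p.2 = q.2 <;> by_cases h2 : n₁ = n₂ <;> simp [h1, h2])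
  simp only [one_mul] at h
  rw [h]
  by_cases hn : n₁ = n₂
  · simp only [hn, if_true] at hvm hv2 ⊢
    rw [U.integral_pilotSignal_mul_conj_mul' j p q
      (F := fun c _ => ((distortionVar P S.κ U.x c t n₂ : ℝ) : ℂ)) (hvm.comp measurable_fst) hv2]
  · simp [hn]

/-! ### Joint moments of the pilot signal and the effective channels -/

/-- Channels and phases separate in a weighted second moment of the noise-free pilot signal. -/
lemma integral_signal_mul_conj_mul (j : Fin L) (p q : Fin B × Fin N)
    {W : (Fin L → Fin K → Fin N → ℂ) → ℂ} {V : (Fin T → Fin N → ℝ) → ℂ}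
    (hW : Measurable W) (hV : Measurable V) (hW2 : MemLp (fun ω => W (U.h j ω)) 2 P) :
    ∫ ω, S.signal (U.h j ω) (U.φ j ω) p * conj (S.signal (U.h j ω) (U.φ j ω) q) *
        (W (U.h j ω) * V (U.φ j ω)) ∂P =
      (∑ i : Fin L × Fin K, ∑ i' : Fin L × Fin K,
        S.pilot i.1 i.2 p.1 * conj (S.pilot i'.1 i'.2 q.1) *
          ∫ ω, U.h j ω i.1 i.2 p.2 * conj (U.h j ω i'.1 i'.2 q.2) * W (U.h j ω) ∂P) *
      ∫ ω, U.cis j (S.τ p.1) p.2 ω * conj (U.cis j (S.τ q.1) q.2 ω) * V (U.φ j ω) ∂P := by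
  have e := U.integral_channels_mul_phases j
    (F := fun c => (∑ i : Fin L × Fin K, S.pilot i.1 i.2 p.1 * c i.1 i.2 p.2) *
      conj (∑ i : Fin L × Fin K, S.pilot i.1 i.2 q.1 * c i.1 i.2 q.2) * W c)
    (G := fun f => Complex.exp (Complex.I * (f (S.τ p.1) p.2 : ℂ)) *
      conj (Complex.exp (Complex.I * (f (S.τ q.1) q.2 : ℂ))) * V f) (by fun_prop) (by fun_prop)
  have hsum := integral_sum_mul_conj_sum_mul (P := P)
    (f := fun (i : Fin L × Fin K) ω => S.pilot i.1 i.2 p.1 * U.h j ω i.1 i.2 p.2)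
    (g := fun (i : Fin L × Fin K) ω => S.pilot i.1 i.2 q.1 * U.h j ω i.1 i.2 q.2)
    (w := fun ω => W (U.h j ω)) (fun i i' => integrable_mul_conj_mul
      ((U.memLp_h j i.1 i.2 p.2).const_mul _) ((U.memLp_h j i'.1 i'.2 q.2).const_mul _) hW2)
  rw [hsum] at e
  refine Eq.trans (integral_congr_ae (ae_of_all _ fun ω => ?_)) (e.trans ?_)
  · simp only [signal_eq, cis, map_mul]
    ring
  · congr 1
    refine Finset.sum_congr rfl fun i _ => Finset.sum_congr rfl fun i' _ => ?_
    rw [← integral_const_mul]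
    refine integral_congr_ae (ae_of_all _ fun ω => ?_)
    simp only [map_mul]
    ring

lemma integral_distortionVar_mul (j : Fin L) (t : Fin T) (n : Fin N) {w : Ω → ℂ}
    (hw : MemLp w 2 P) :
    ∫ ω, ((distortionVar P S.κ U.x (U.h j ω) t n : ℝ) : ℂ) * w ω ∂P =
      ((S.κ : ℝ) : ℂ) ^ 2 * ∑ i : Fin L × Fin K, ((∫ ω, ‖U.x i.1 i.2 t ω‖ ^ 2 ∂P : ℝ) : ℂ) *
        ∫ ω, U.h j ω i.1 i.2 n * conj (U.h j ω i.1 i.2 n) * w ω ∂P := by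
  have e (ω : Ω) : ((distortionVar P S.κ U.x (U.h j ω) t n : ℝ) : ℂ) * w ω =
      ((S.κ : ℝ) : ℂ) ^ 2 * ∑ i : Fin L × Fin K, ((∫ ω, ‖U.x i.1 i.2 t ω‖ ^ 2 ∂P : ℝ) : ℂ) *
        (U.h j ω i.1 i.2 n * conj (U.h j ω i.1 i.2 n) * w ω) := by
    rw [coe_distortionVar, Fintype.sum_prod_type]
    simp_rw [Complex.mul_conj, Complex.normSq_eq_norm_sq]
    push_cast
    simp_rw [Finset.mul_sum, Finset.sum_mul]
    refine Finset.sum_congr rfl fun i _ => Finset.sum_congr rfl fun i' _ => ?_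
    ring
  simp_rw [e]
  rw [integral_const_mul, integral_finsetSum]
  · simp_rw [integral_const_mul]
  · exact fun i _ => (integrable_mul_conj_mul (U.memLp_h j i.1 i.2 n) (U.memLp_h j i.1 i.2 n)
      hw).const_mul _

lemma integral_norm_sq_x_pilot (l : Fin L) (m : Fin K) (b : Fin B) :
    ∫ ω, ‖U.x l m (S.τ b) ω‖ ^ 2 ∂P = ‖S.pilot l m b‖ ^ 2 := by
  simp [U.x_pilot]

lemma integral_h_mul_conj (j : Fin L) (i i' : Fin L × Fin K) (n₁ n₂ : Fin N) :
    ∫ ω, U.h j ω i.1 i.2 n₁ * conj (U.h j ω i'.1 i'.2 n₂) ∂P =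
      if i = i' ∧ n₁ = n₂ then ((S.lam j i.1 i.2 n₁ : ℝ) : ℂ) else 0 := by
  refine (U.integral_channels j (f := fun z => z i n₁ * conj (z i' n₂)) (by fun_prop)).trans ?_
  refine (integral_mul_conj_gaussianField _ (i, n₁) (i', n₂)).trans ?_
  simp [Prod.ext_iff]

lemma integral_h_quartic (j : Fin L) (i i' o : Fin L × Fin K) (n₁ n₂ : Fin N) :
    ∫ ω, U.h j ω i.1 i.2 n₁ * conj (U.h j ω i'.1 i'.2 n₂) *
        (conj (U.h j ω o.1 o.2 n₁) * U.h j ω o.1 o.2 n₂) ∂P =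
      (if i = i' ∧ n₁ = n₂ then
        ((S.lam j i.1 i.2 n₁ * S.lam j o.1 o.2 n₁ : ℝ) : ℂ) else 0) +
      if i = o ∧ i' = o then
        ((S.lam j o.1 o.2 n₁ * S.lam j o.1 o.2 n₂ : ℝ) : ℂ) else 0 := by
  refine (U.integral_channels j (f := fun z => z i n₁ * conj (z i' n₂) *
    (conj (z o n₁) * z o n₂)) (by fun_prop)).trans ?_
  refine (integral_quartic_gaussianField _ (i, n₁) (i', n₂) (o, n₁) (o, n₂)).trans ?_
  simp only [Prod.mk.injEq, true_and, and_true]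
  congr 1
  · by_cases h : i = i' ∧ n₁ = n₂
    · simp [h]
    · simp only [h, false_and, if_false]
  · by_cases h : i = o ∧ i' = o
    · simp [h.1, h.2]
    · simp only [h, if_false]

/-- The correlation matrix of the pilot signal is `Ψ_j`. -/
lemma integral_pilotSignal_mul_conj (j : Fin L) (p q : Fin B × Fin N) :
    ∫ ω, U.pilotSignal j ω p * conj (U.pilotSignal j ω q) ∂P = S.Psi j p q := by
  have h := U.integral_pilotSignal_mul_conj_mul' j p q (F := fun _ _ => 1) measurable_const
    (memLp_const 1)
  have hs := U.integral_signal_mul_conj_mul j p q (W := fun _ => 1) (V := fun _ => 1)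
    measurable_const measurable_const (memLp_const 1)
  have hv := U.integral_distortionVar_mul j (S.τ p.1) p.2 (w := fun _ => 1) (memLp_const 1)
  simp only [mul_one, U.integral_h_mul_conj, integral_norm_sq_x_pilot] at h hs hv
  rw [h, hs, hv, S.Psi_apply]
  obtain ⟨b₁, n₁⟩ := p
  obtain ⟨b₂, n₂⟩ := q
  simp only [UplinkParams.X_apply]
  by_cases hn : n₁ = n₂
  · subst hn
    rw [U.integral_cis_mul_conj, ← Fintype.sum_prod_type' (f := fun l m =>
      (S.pilot l m b₁ * conj (S.pilot l m b₂) * (S.decay (S.τ b₁) (S.τ b₂) : ℂ) +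
        if b₁ = b₂ then ((S.κ : ℝ) : ℂ) ^ 2 * ((‖S.pilot l m b₁‖ ^ 2 : ℝ) : ℂ) else 0) *
          ((S.lam j l m n₁ : ℝ) : ℂ))]
    by_cases hb : b₁ = b₂
    · subst hb
      simp only [and_true, mul_ite, mul_zero, Finset.sum_ite_eq, Finset.mem_univ, if_true,
        add_mul, Finset.sum_add_distrib, Finset.sum_mul, Finset.mul_sum]
      simp only [integral_const, probReal_univ, one_smul, mul_one, ← add_assoc]
      congr 2
      · exact Finset.sum_congr rfl fun i _ => by ring
      · exact Finset.sum_congr rfl fun i _ => by ring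
    · simp only [and_true, mul_ite, mul_zero, Finset.sum_ite_eq, Finset.mem_univ, if_true,
        Prod.mk.injEq, hb, if_false, add_zero, Finset.sum_mul]
      exact Finset.sum_congr rfl fun i _ => by ring
  · simp [hn]

/-- The expectation of the phase factors in a fourth moment of the pilot signal and an effective
channel. -/
noncomputable def phaseCorr (j : Fin L) (t : Fin T) (p q : Fin B × Fin N) : ℂ :=
  ∫ ω, U.cis j (S.τ p.1) p.2 ω * conj (U.cis j (S.τ q.1) q.2 ω) *
    (conj (U.cis j t p.2 ω) * U.cis j t q.2 ω) ∂P

lemma phaseCorr_same (j : Fin L) (t : Fin T) (b₁ b₂ : Fin B) (n : Fin N) :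
    U.phaseCorr j t (b₁, n) (b₂, n) = (S.decay (S.τ b₁) (S.τ b₂) : ℂ) := by
  rw [phaseCorr, ← U.integral_cis_mul_conj j n]
  refine integral_congr_ae (ae_of_all _ fun ω => ?_)
  simp only
  rw [mul_comm (conj (U.cis j t n ω)), cis_mul_conj_self, mul_one]

/-- A common oscillator cancels the phases at the data time. -/
lemma phaseCorr_of_commonLO {j : Fin L} (h : U.CommonLO j) (t : Fin T) (p q : Fin B × Fin N) :
    U.phaseCorr j t p q = (S.decay (S.τ p.1) (S.τ q.1) : ℂ) := by
  rw [phaseCorr, ← U.integral_cis_mul_conj j p.2]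
  refine integral_congr_ae ?_
  filter_upwards [h p.2 q.2 t, h p.2 q.2 (S.τ q.1)] with ω h1 h2
  have e1 : U.cis j t q.2 ω = U.cis j t p.2 ω := by rw [cis, cis, h1]
  have e2 : U.cis j (S.τ q.1) q.2 ω = U.cis j (S.τ q.1) p.2 ω := by rw [cis, cis, h2]
  rw [e1, e2, mul_comm (conj (U.cis j t p.2 ω)), cis_mul_conj_self, mul_one]

/-- With separate oscillators, the phase factors of two different antennas are independent. -/
lemma phaseCorr_of_separateLOs {j : Fin L} (h : U.SeparateLOs j) (t : Fin T)
    {p q : Fin B × Fin N} (hpq : p.2 ≠ q.2) :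
    U.phaseCorr j t p q = (S.decay t (S.τ p.1) : ℂ) * (S.decay t (S.τ q.1) : ℂ) := by
  have hmφ := U.measurable_φ j
  have hind := (h.indepFun hpq).comp
    (φ := fun f : Fin T → ℝ => Complex.exp (Complex.I * (f (S.τ p.1) : ℂ)) *
      conj (Complex.exp (Complex.I * (f t : ℂ))))
    (ψ := fun f : Fin T → ℝ => Complex.exp (Complex.I * (f t : ℂ)) *
      conj (Complex.exp (Complex.I * (f (S.τ q.1) : ℂ)))) (by fun_prop) (by fun_prop)
  have e := hind.integral_fun_mul_eq_mul_integral
    (Measurable.aestronglyMeasurable (by simp only [Function.comp_def]; fun_prop))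
    (Measurable.aestronglyMeasurable (by simp only [Function.comp_def]; fun_prop))
  have e1 := U.integral_cis_mul_conj j p.2 (S.τ p.1) t
  have e2 := U.integral_cis_mul_conj j q.2 t (S.τ q.1)
  simp only [cis] at e1 e2
  simp only [Function.comp_apply, e1, e2] at e
  rw [UplinkParams.decay, abs_sub_comm, ← UplinkParams.decay, ← e, phaseCorr]
  refine integral_congr_ae (ae_of_all _ fun ω => ?_)
  simp only [cis]
  ring

/-- The channel-dependent part of the fourth moment, beyond the part that comes from pairing the
pilot signal with itself. -/
noncomputable def crossCorr (j l : Fin L) (m : Fin K) (t : Fin T) (p q : Fin B × Fin N) : ℂ :=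
  S.pilot l m p.1 * conj (S.pilot l m q.1) * U.phaseCorr j t p q +
    if p = q then ((S.κ : ℝ) : ℂ) ^ 2 * ((‖S.pilot l m p.1‖ ^ 2 : ℝ) : ℂ) else 0

lemma crossCorr_same (j l : Fin L) (m : Fin K) (t : Fin T) (b₁ b₂ : Fin B) (n : Fin N) :
    U.crossCorr j l m t (b₁, n) (b₂, n) = S.X l m b₁ b₂ := by
  simp [crossCorr, phaseCorr_same, UplinkParams.X_apply]

/-- Wick's formula for the pilot signal and the effective channel: the channel is paired with itself,
which leaves `Ψ_j`, or with the contribution of the same user to the pilot signal. -/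
lemma integral_pilotSignal_mul_conj_mul_effChannel (j l : Fin L) (m : Fin K) (t : Fin T)
    (p q : Fin B × Fin N) :
    ∫ ω, U.pilotSignal j ω p * conj (U.pilotSignal j ω q) *
        (conj (U.effChannel j l m t ω p.2) * U.effChannel j l m t ω q.2) ∂P =
      (if p.2 = q.2 then ((S.lam j l m p.2 : ℝ) : ℂ) * S.Psi j p q else 0) +
        ((S.lam j l m p.2 : ℝ) : ℂ) * ((S.lam j l m q.2 : ℝ) : ℂ) * U.crossCorr j l m t p q := by
  have hW2 : MemLp (fun ω => conj (U.h j ω l m p.2) * U.h j ω l m q.2) 2 P :=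
    memLp_two_mul_of_memLp_four (U.memLp_h j l m p.2).conj (U.memLp_h j l m q.2)
  have hg (ω : Ω) : conj (U.effChannel j l m t ω p.2) * U.effChannel j l m t ω q.2 =
      (conj (U.h j ω l m p.2) * U.h j ω l m q.2) *
        (conj (U.cis j t p.2 ω) * U.cis j t q.2 ω) := by
    simp only [effChannel_apply, map_mul]
    ring
  have hg2 : MemLp (fun ω => (conj (U.h j ω l m p.2) * U.h j ω l m q.2) *
      (conj (U.cis j t p.2 ω) * U.cis j t q.2 ω)) 2 P := by
    simp_rw [← hg]
    exact memLp_two_mul_of_memLp_four (U.memLp_effChannel j l m t p.2).conj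
      (U.memLp_effChannel j l m t q.2)
  simp_rw [hg]
  have h := U.integral_pilotSignal_mul_conj_mul' j p q
    (F := fun c f => (conj (c l m p.2) * c l m q.2) *
      (conj (Complex.exp (Complex.I * (f t p.2 : ℂ))) * Complex.exp (Complex.I * (f t q.2 : ℂ))))
    (by simp only [Function.uncurry_def]; fun_prop) hg2
  have hs := U.integral_signal_mul_conj_mul j p q (W := fun c => conj (c l m p.2) * c l m q.2)
    (V := fun f => conj (Complex.exp (Complex.I * (f t p.2 : ℂ))) *
      Complex.exp (Complex.I * (f t q.2 : ℂ))) (by fun_prop) (by fun_prop) hW2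
  simp only [← cis.eq_def] at h hs
  simp only [U.integral_h_quartic j _ _ (l, m)] at hs
  rw [h, hs, ← phaseCorr.eq_def, S.Psi_apply, crossCorr]
  obtain ⟨b₁, n₁⟩ := p
  obtain ⟨b₂, n₂⟩ := q
  simp only [UplinkParams.X_apply]
  by_cases hn : n₁ = n₂
  · subst hn
    rw [U.phaseCorr_same, ← Fintype.sum_prod_type' (f := fun l m =>
      (S.pilot l m b₁ * conj (S.pilot l m b₂) * (S.decay (S.τ b₁) (S.τ b₂) : ℂ) +
        if b₁ = b₂ then ((S.κ : ℝ) : ℂ) ^ 2 * ((‖S.pilot l m b₁‖ ^ 2 : ℝ) : ℂ) else 0) *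
          ((S.lam j l m n₁ : ℝ) : ℂ))]
    have hc (ω : Ω) : conj (U.cis j t n₁ ω) * U.cis j t n₁ ω = 1 := by
      rw [mul_comm, cis_mul_conj_self]
    have hd (f : Fin L × Fin K → Fin L × Fin K → ℂ) : (∑ i, ∑ i', if i = (l, m) then
        if i' = (l, m) then f i i' else 0 else 0) = f (l, m) (l, m) := by
      rw [Finset.sum_eq_single (l, m) (fun i _ hi => by simp [hi]) (by simp)]
      simp
    have hv := U.integral_distortionVar_mul j (S.τ b₁) n₁ hW2
    have hh := U.integral_h_mul_conj j (l, m) (l, m) n₁ n₁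
    simp only [U.integral_h_quartic j _ _ (l, m), integral_norm_sq_x_pilot] at hv
    simp only [mul_comm (conj (U.h j _ l m n₁))] at hv
    simp only [hc, mul_one, mul_comm (conj (U.h j _ l m n₁))]
    rw [hv, hh]
    simp only [and_true, and_self, if_true, mul_add, add_mul, mul_ite, ite_mul, mul_zero, zero_mul,
      Finset.sum_add_distrib, Finset.sum_ite_eq, Finset.sum_ite_eq', Finset.mem_univ, ite_and,
      Prod.mk.injEq, Finset.mul_sum, Finset.sum_mul, hd]
    have hA (b₂ : Fin B) : ∑ i : Fin L × Fin K, S.pilot i.1 i.2 b₁ * conj (S.pilot i.1 i.2 b₂) *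
        (((S.lam j i.1 i.2 n₁ : ℝ) : ℂ) * ((S.lam j l m n₁ : ℝ) : ℂ)) *
          (S.decay (S.τ b₁) (S.τ b₂) : ℂ) =
        ∑ i : Fin L × Fin K, ((S.lam j l m n₁ : ℝ) : ℂ) *
          (S.pilot i.1 i.2 b₁ * conj (S.pilot i.1 i.2 b₂) * (S.decay (S.τ b₁) (S.τ b₂) : ℂ) *
            ((S.lam j i.1 i.2 n₁ : ℝ) : ℂ)) :=
      Finset.sum_congr rfl fun i _ => by ring
    have hB : ∑ i : Fin L × Fin K, ((S.κ : ℝ) : ℂ) ^ 2 * ((‖S.pilot i.1 i.2 b₁‖ : ℂ) ^ 2 *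
          (((S.lam j i.1 i.2 n₁ : ℝ) : ℂ) * ((S.lam j l m n₁ : ℝ) : ℂ))) =
        ∑ i : Fin L × Fin K, ((S.lam j l m n₁ : ℝ) : ℂ) * (((S.κ : ℝ) : ℂ) ^ 2 *
          (‖S.pilot i.1 i.2 b₁‖ : ℂ) ^ 2 * ((S.lam j i.1 i.2 n₁ : ℝ) : ℂ)) :=
      Finset.sum_congr rfl fun i _ => by ring
    by_cases hb : b₁ = b₂
    · subst hb
      simp only [if_true]
      push_cast
      rw [hA b₁, hB]
      ring
    · simp only [hb, if_false, Finset.sum_const_zero]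
      push_cast
      rw [hA b₂]
      ring
  · simp [hn, ite_and]
    ring

lemma integral_effChannel_mul_conj_pilotSignal (j l : Fin L) (m : Fin K) (t : Fin T) (n : Fin N)
    (q : Fin B × Fin N) :
    ∫ ω, U.effChannel j l m t ω n * conj (U.pilotSignal j ω q) ∂P =
      if n = q.2 then S.xRow l m t q.1 * ((S.lam j l m n : ℝ) : ℂ) else 0 := by
  have hg := U.memLp_effChannel j l m t n
  have hint {f : Ω → ℂ} (hf : MemLp f 4 P) :
      Integrable (fun ω => U.effChannel j l m t ω n * conj (f ω)) P := by
    simpa using integrable_mul_conj_mul hg hf (memLp_const 1)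
  have hA : Measurable (Function.uncurry fun (c : Fin L → Fin K → Fin N → ℂ)
      (f : Fin T → Fin N → ℝ) => Complex.exp (Complex.I * (f t n : ℂ)) * c l m n) := by
    simp only [Function.uncurry_def]; fun_prop
  have hv : ∫ ω, U.effChannel j l m t ω n * conj (U.υ j ω (S.τ q.1) q.2) ∂P = 0 := by
    have hi := hint (U.memLp_υ j (S.τ q.1) q.2)
    have h := U.integral_environment_mul j
      (F := fun c f => Complex.exp (Complex.I * (f t n : ℂ)) * c l m n) (G := fun _ => 1)
      (J := fun z => conj (z (S.τ q.1) q.2)) (k := fun _ => 0) hA measurable_const (by fun_prop)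
      measurable_const (by simpa [effChannel_apply, cis] using hi)
      (fun c => integral_conj_gaussianField _ _ _)
    simpa [effChannel_apply, cis] using h
  have hn : ∫ ω, U.effChannel j l m t ω n * conj (U.η j ω (S.τ q.1) q.2) ∂P = 0 := by
    have hi := hint (U.memLp_η j (S.τ q.1) q.2)
    have h0 := (U.integral_noise j (f := fun z => conj (z (S.τ q.1) q.2)) (by fun_prop)).trans
      (integral_conj_gaussianField _ _ _)
    have h := U.integral_environment_mul j
      (F := fun c f => Complex.exp (Complex.I * (f t n : ℂ)) * c l m n)
      (G := fun z => conj (z (S.τ q.1) q.2)) (J := fun _ => 1) (k := fun _ => 1) hA (by fun_prop)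
      measurable_const measurable_const (by simpa [effChannel_apply, cis] using hi) (by simp)
    simpa [effChannel_apply, cis, h0] using h
  have hs : ∫ ω, U.effChannel j l m t ω n * conj (S.signal (U.h j ω) (U.φ j ω) q) ∂P =
      if n = q.2 then S.xRow l m t q.1 * ((S.lam j l m n : ℝ) : ℂ) else 0 := by
    have h := U.integral_channels_mul_phases j
      (F := fun c => c l m n * conj (∑ i : Fin L × Fin K, S.pilot i.1 i.2 q.1 * c i.1 i.2 q.2))
      (G := fun f => Complex.exp (Complex.I * (f t n : ℂ)) *
        conj (Complex.exp (Complex.I * (f (S.τ q.1) q.2 : ℂ)))) (by fun_prop) (by fun_prop)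
    have e : ∫ ω, U.h j ω l m n *
        conj (∑ i : Fin L × Fin K, S.pilot i.1 i.2 q.1 * U.h j ω i.1 i.2 q.2) ∂P =
        if n = q.2 then conj (S.pilot l m q.1) * ((S.lam j l m n : ℝ) : ℂ) else 0 := by
      have hh (i : Fin L × Fin K) : ∫ ω, U.h j ω l m n *
          (conj (S.pilot i.1 i.2 q.1) * conj (U.h j ω i.1 i.2 q.2)) ∂P =
          conj (S.pilot i.1 i.2 q.1) *
            if (l, m) = i ∧ n = q.2 then ((S.lam j l m n : ℝ) : ℂ) else 0 := by
        rw [← U.integral_h_mul_conj j (l, m) i n q.2, ← integral_const_mul]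
        exact integral_congr_ae (ae_of_all _ fun ω => by simp only; ring)
      simp only [map_sum, map_mul, Finset.mul_sum]
      rw [integral_finsetSum]
      · simp_rw [hh]
        simp [ite_and]
      · intro i _
        have := integrable_mul_conj_mul (U.memLp_h j l m n) ((U.memLp_h j i.1 i.2 q.2).const_mul
          (S.pilot i.1 i.2 q.1)) (memLp_const 1)
        simpa using this
    rw [e] at h
    simp only [← cis.eq_def] at h
    refine Eq.trans (integral_congr_ae (ae_of_all _ fun ω => ?_)) (h.trans ?_)
    · simp only [effChannel_apply, signal_eq, map_mul]
      ring
    · split_ifs with hq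
      · rw [hq, U.integral_cis_mul_conj, S.xRow_apply]
        ring
      · simp
  simp_rw [pilotSignal_apply, map_add, mul_add]
  rw [integral_add ((hint (U.memLp_signal j q)).fun_add (hint (U.memLp_υ j _ _)))
    (hint (U.memLp_η j _ _)), integral_add (hint (U.memLp_signal j q)) (hint (U.memLp_υ j _ _)),
    hs, hv, hn, add_zero, add_zero]

/-- The distortion noise acts like the effective channels of all users, weighted by their powers,
with the cross terms between different antennas removed. -/
lemma integral_pilotSignal_mul_conj_mul_distortion' (j : Fin L) {t : Fin T}
    (ht : t ∈ S.dataTimes) (p q : Fin B × Fin N) :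
    ∫ ω, U.pilotSignal j ω p * conj (U.pilotSignal j ω q) *
        (conj (U.υ j ω t p.2) * U.υ j ω t q.2) ∂P =
      if p.2 = q.2 then ((S.κ : ℝ) : ℂ) ^ 2 * ∑ l, ∑ m, ((S.p l m : ℝ) : ℂ) *
        (((S.lam j l m p.2 : ℝ) : ℂ) * S.Psi j p q +
          ((S.lam j l m p.2 : ℝ) : ℂ) ^ 2 * S.X l m p.1 q.1) else 0 := by
  rw [U.integral_pilotSignal_mul_conj_mul_distortion j p q ht]
  obtain ⟨b₁, n₁⟩ := p
  obtain ⟨b₂, n₂⟩ := q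
  simp only
  split_ifs with hn
  · subst hn
    simp_rw [mul_comm _ ((distortionVar P S.κ U.x (U.h j _) t n₁ : ℝ) : ℂ)]
    rw [U.integral_distortionVar_mul j t n₁
      (memLp_two_mul_of_memLp_four (U.memLp_pilotSignal j _) (U.memLp_pilotSignal j _).conj),
      Fintype.sum_prod_type]
    congr 1
    refine Finset.sum_congr rfl fun l _ => Finset.sum_congr rfl fun m _ => ?_
    rw [U.x_power l m t ht]
    congr 1
    have h := U.integral_pilotSignal_mul_conj_mul_effChannel j l m t (b₁, n₁) (b₂, n₁)
    rw [crossCorr_same] at h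
    simp only [if_true] at h
    rw [pow_two, ← h]
    refine integral_congr_ae (ae_of_all _ fun ω => ?_)
    simp only [effChannel_apply, map_mul]
    linear_combination (-(U.pilotSignal j ω (b₁, n₁) * conj (U.pilotSignal j ω (b₂, n₁)) *
      U.h j ω l m n₁ * conj (U.h j ω l m n₁))) * U.cis_mul_conj_self j t n₁ ω
  · rfl

end Uplink

/-! ### The correlation matrix and the coefficients of the estimator -/

namespace UplinkParams

variable {L K N T B : ℕ} (S : UplinkParams L K N T B)

lemma decay_comm (s t : Fin T) : S.decay s t = S.decay t s := by
  rw [decay, decay, abs_sub_comm]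

lemma conj_X (l : Fin L) (m : Fin K) (b₁ b₂ : Fin B) :
    conj (S.X l m b₁ b₂) = S.X l m b₂ b₁ := by
  rw [X_apply, X_apply, S.decay_comm (S.τ b₂)]
  by_cases hb : b₁ = b₂
  · subst hb
    simp [mul_comm]
  · simp [hb, Ne.symm hb, mul_comm]

lemma isHermitian_Psi (j : Fin L) : (S.Psi j).IsHermitian := by
  ext p q
  rw [Matrix.conjTranspose_apply, Psi_apply, Psi_apply]
  obtain ⟨b₁, n₁⟩ := p
  obtain ⟨b₂, n₂⟩ := q
  simp only [star_add, Complex.star_def]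
  by_cases hn : n₁ = n₂
  · subst hn
    simp [conj_X, eq_comm, apply_ite (starRingEnd ℂ)]
  · simp [hn, Ne.symm hn]

lemma Psi_inv_apply_of_ne (j : Fin L) (hdet : IsUnit (S.Psi j).det) {p q : Fin B × Fin N}
    (hpq : p.2 ≠ q.2) : (S.Psi j)⁻¹ p q = 0 := by
  -- `Ψ` commutes with a diagonal matrix that separates the antennas, hence so does `Ψ⁻¹`
  set D : Matrix (Fin B × Fin N) (Fin B × Fin N) ℂ :=
    Matrix.diagonal fun p => ((p.2 : ℕ) : ℂ) with hD
  have hc : D * S.Psi j = S.Psi j * D := by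
    ext p q
    rw [hD, Matrix.diagonal_mul, Matrix.mul_diagonal, Psi_apply]
    by_cases h : p.2 = q.2
    · rw [h, mul_comm]
    · have : p ≠ q := fun h' => h (by rw [h'])
      simp [h, this]
  have hc' : (S.Psi j)⁻¹ * D = D * (S.Psi j)⁻¹ := by
    calc (S.Psi j)⁻¹ * D = (S.Psi j)⁻¹ * (D * S.Psi j) * (S.Psi j)⁻¹ := by
          rw [Matrix.mul_assoc, Matrix.mul_assoc, Matrix.mul_nonsing_inv _ hdet, Matrix.mul_one]
      _ = D * (S.Psi j)⁻¹ := by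
          rw [hc, ← Matrix.mul_assoc, Matrix.nonsing_inv_mul _ hdet, Matrix.one_mul]
  have h := congrFun (congrFun hc' p) q
  rw [hD, Matrix.diagonal_mul, Matrix.mul_diagonal, mul_comm] at h
  have h' : (((p.2 : ℕ) : ℂ) - ((q.2 : ℕ) : ℂ)) * (S.Psi j)⁻¹ p q = 0 := by
    rw [sub_mul, h, sub_self]
  refine (mul_eq_zero.1 h').resolve_left (sub_ne_zero.2 fun e => hpq ?_)
  exact Fin.ext (by exact_mod_cast e)

lemma rowKron_apply (r : Fin B → ℂ) (M : Matrix (Fin N) (Fin N) ℂ) (n : Fin N)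
    (q : Fin B × Fin N) : rowKron r M n q = r q.1 * M n q.2 := rfl

lemma colKron_apply (c : Fin B → ℂ) (M : Matrix (Fin N) (Fin N) ℂ) (p : Fin B × Fin N)
    (n : Fin N) : colKron c M p n = c p.1 * M p.2 n := rfl

/-- The coefficient of the pilot observation `(b, n)` in the estimate of the channel to antenna `n`,
without the factor `λ_{jjk}^{(n)}`. Observations at other antennas do not enter. -/
noncomputable def weight (j : Fin L) (k : Fin K) (t : Fin T) (n : Fin N) (b : Fin B) : ℂ :=
  ∑ b', S.xRow j k t b' * (S.Psi j)⁻¹ (b', n) (b, n)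

variable {j : Fin L} (k : Fin K) (t : Fin T)

lemma estMatrix_apply (hdet : IsUnit (S.Psi j).det) (n : Fin N) (q : Fin B × Fin N) :
    S.estMatrix j j k t n q =
      if n = q.2 then ((S.lam j j k n : ℝ) : ℂ) * S.weight j k t n q.1 else 0 := by
  rw [estMatrix, Matrix.mul_apply, Fintype.sum_prod_type]
  simp only [rowKron_apply, Lam, Matrix.diagonal_apply, mul_ite, mul_zero, ite_mul, zero_mul,
    Finset.sum_ite_eq, Finset.mem_univ, if_true]
  split_ifs with h
  · rw [weight, Finset.mul_sum]
    refine Finset.sum_congr rfl fun b _ => ?_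
    rw [h]
    ring
  · refine Finset.sum_eq_zero fun b _ => ?_
    rw [S.Psi_inv_apply_of_ne j hdet (by exact h), mul_zero]

lemma estMatrix_mul_Psi (hdet : IsUnit (S.Psi j).det) :
    S.estMatrix j j k t * S.Psi j = rowKron (S.xRow j k t) (S.Lam j j k) := by
  rw [estMatrix, Matrix.mul_assoc, Matrix.nonsing_inv_mul _ hdet, Matrix.mul_one]

lemma conj_xRow (l : Fin L) (m : Fin K) (b : Fin B) :
    conj (S.xRow l m t b) = S.xCol l m t b := by
  rw [xRow_apply, xCol_apply]
  simp [mul_comm]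

lemma colKron_eq_conjTranspose (l : Fin L) (m : Fin K) :
    colKron (S.xCol l m t) (S.Lam j l m) = (rowKron (S.xRow l m t) (S.Lam j l m))ᴴ := by
  ext p n
  rw [Matrix.conjTranspose_apply, colKron_apply, rowKron_apply, star_mul', Complex.star_def,
    conj_xRow, Lam, Matrix.diagonal_apply, Matrix.diagonal_apply]
  by_cases h : p.2 = n
  · simp [h]
  · simp [h, Ne.symm h]

/-- The coefficient of the pilot observation `(b, n)` in the estimate for antenna `n`. -/
noncomputable def coeff (j : Fin L) (k : Fin K) (t : Fin T) (p : Fin B × Fin N) : ℂ :=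
  ((S.lam j j k p.2 : ℝ) : ℂ) * S.weight j k t p.2 p.1

lemma sum_estMatrix_mul (hdet : IsUnit (S.Psi j).det) (n : Fin N) (f : Fin B × Fin N → ℂ) :
    ∑ p, S.estMatrix j j k t n p * f p = ∑ b, S.coeff j k t (b, n) * f (b, n) := by
  rw [Fintype.sum_prod_type]
  refine Finset.sum_congr rfl fun b _ => ?_
  simp [S.estMatrix_apply k t hdet, coeff]

lemma crossMat_diag (hdet : IsUnit (S.Psi j).det) (l : Fin L) (m : Fin K) (n : Fin N) :
    S.crossMat j k l m t n n =
      ∑ b, S.coeff j k t (b, n) * (S.xCol l m t b * ((S.lam j l m n : ℝ) : ℂ)) := by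
  rw [crossMat, ← estMatrix.eq_def, Matrix.mul_apply, S.sum_estMatrix_mul k t hdet]
  simp [colKron_apply, Lam]

/-- The diagonal of `Q_{jk}` consists of the mean powers of the entries of the estimate. -/
lemma crossMat_self_diag (hdet : IsUnit (S.Psi j).det) (n : Fin N) :
    S.crossMat j k j k t n n = ∑ b₁, ∑ b₂, S.coeff j k t (b₁, n) *
      conj (S.coeff j k t (b₂, n)) * S.Psi j (b₁, n) (b₂, n) := by
  rw [crossMat, ← estMatrix.eq_def, colKron_eq_conjTranspose, ← S.estMatrix_mul_Psi k t hdet,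
    Matrix.conjTranspose_mul, (S.isHermitian_Psi j).eq, Matrix.mul_apply,
    S.sum_estMatrix_mul k t hdet]
  refine Finset.sum_congr rfl fun b₁ _ => ?_
  have e : (S.Psi j * (S.estMatrix j j k t)ᴴ) (b₁, n) n =
      ∑ b₂, conj (S.coeff j k t (b₂, n)) * S.Psi j (b₁, n) (b₂, n) := by
    rw [Matrix.mul_apply, Fintype.sum_prod_type]
    refine Finset.sum_congr rfl fun b₂ _ => ?_
    rw [Finset.sum_eq_single n (fun n' _ h => by
      simp [S.estMatrix_apply k t hdet, Ne.symm h]) (by simp)]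
    simp [S.estMatrix_apply k t hdet, coeff, mul_comm]
  rw [e, Finset.mul_sum]
  exact Finset.sum_congr rfl fun b₂ _ => by ring

/-- The scalars `q_{n₁n₂}(Y)` are sesquilinear forms in the coefficients of the estimator. -/
lemma quad_eq (hdet : IsUnit (S.Psi j).det) (Y : Matrix (Fin B) (Fin B) ℂ) (n₁ n₂ : Fin N) :
    S.quad j k t Y n₁ n₂ =
      ∑ b₁, ∑ b₂, S.weight j k t n₁ b₁ * conj (S.weight j k t n₂ b₂) * Y b₁ b₂ := by
  have h1 (q : Fin B × Fin N) : (vecKron (S.xRow j k t) (Pi.single n₁ 1) ᵥ* (S.Psi j)⁻¹) q =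
      if q.2 = n₁ then S.weight j k t n₁ q.1 else 0 := by
    rw [Matrix.vecMul, dotProduct, Fintype.sum_prod_type]
    have (b : Fin B) : ∑ n, vecKron (S.xRow j k t) (Pi.single n₁ 1) (b, n) *
        (S.Psi j)⁻¹ (b, n) q = S.xRow j k t b * (S.Psi j)⁻¹ (b, n₁) q := by
      rw [Finset.sum_eq_single n₁ (fun n _ h => by simp [vecKron, h]) (by simp)]
      simp [vecKron]
    simp_rw [this]
    split_ifs with h
    · rw [weight]
      exact Finset.sum_congr rfl fun b _ => by rw [← h]
    · exact Finset.sum_eq_zero fun b _ => by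
        rw [S.Psi_inv_apply_of_ne j hdet (Ne.symm h), mul_zero]
  have h2 (q : Fin B × Fin N) : ((S.Psi j)⁻¹ *ᵥ vecKron (S.xCol j k t) (Pi.single n₂ 1)) q =
      if q.2 = n₂ then conj (S.weight j k t n₂ q.1) else 0 := by
    have hherm (p q : Fin B × Fin N) : (S.Psi j)⁻¹ q p = conj ((S.Psi j)⁻¹ p q) :=
      ((S.isHermitian_Psi j).inv.apply q p).symm
    rw [Matrix.mulVec, dotProduct, Fintype.sum_prod_type]
    have (b : Fin B) : ∑ n, (S.Psi j)⁻¹ q (b, n) *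
        vecKron (S.xCol j k t) (Pi.single n₂ 1) (b, n) =
          conj (S.xRow j k t b * (S.Psi j)⁻¹ (b, n₂) q) := by
      rw [Finset.sum_eq_single n₂ (fun n _ h => by simp [vecKron, h]) (by simp)]
      simp [vecKron, hherm (b, n₂) q, conj_xRow, mul_comm]
    simp_rw [this]
    split_ifs with h
    · rw [weight, map_sum]
      exact Finset.sum_congr rfl fun b _ => by rw [← h]
    · exact Finset.sum_eq_zero fun b _ => by
        rw [S.Psi_inv_apply_of_ne j hdet (Ne.symm h), mul_zero, map_zero]
  rw [quad, ← Matrix.mulVec_mulVec, ← Matrix.mulVec_mulVec, Matrix.dotProduct_mulVec, dotProduct,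
    Fintype.sum_prod_type]
  refine Finset.sum_congr rfl fun b₁ _ => ?_
  rw [Finset.sum_eq_single n₁ (fun n _ h => by rw [h1]; simp [h]) (by simp), h1, Matrix.mulVec,
    dotProduct, Fintype.sum_prod_type]
  simp only [if_true, Finset.mul_sum]
  refine Finset.sum_congr rfl fun b₂ _ => ?_
  rw [Finset.sum_eq_single n₂ (fun n _ h => by rw [h2]; simp [h]) (by simp), h2]
  simp
  ring

lemma mul_quad_eq (hdet : IsUnit (S.Psi j).det) (Y : Matrix (Fin B) (Fin B) ℂ) (n₁ n₂ : Fin N) :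
    ((S.lam j j k n₁ : ℝ) : ℂ) * ((S.lam j j k n₂ : ℝ) : ℂ) * S.quad j k t Y n₁ n₂ =
      ∑ b₁, ∑ b₂, S.coeff j k t (b₁, n₁) * conj (S.coeff j k t (b₂, n₂)) * Y b₁ b₂ := by
  rw [S.quad_eq k t hdet]
  simp only [Finset.mul_sum]
  refine Finset.sum_congr rfl fun b₁ _ => Finset.sum_congr rfl fun b₂ _ => ?_
  simp only [coeff, map_mul, Complex.conj_ofReal]
  ring

end UplinkParams

namespace Uplink

variable {L K N T B : ℕ} {S : UplinkParams L K N T B}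
  {Ω : Type*} [MeasurableSpace Ω] {P : Measure Ω} [IsProbabilityMeasure P] (U : Uplink S P)

/-! ### The estimator and its moments -/

/-- The quadratic form of `Ψ_j` is the mean power of a noise-free observation, plus that of the
distortion, plus a positive multiple of the squared norm. -/
lemma isUnit_det_Psi (U : Uplink S P) (hξ : 0 < S.ξ) (j : Fin L) : IsUnit (S.Psi j).det := by
  rw [isUnit_iff_ne_zero]
  intro h0
  obtain ⟨v, hv, hΨ⟩ := Matrix.exists_mulVec_eq_zero_iff.2 h0
  have hs := U.memLp_signal j
  have hentry (p q : Fin B × Fin N) : S.Psi j p q =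
      ∫ ω, S.signal (U.h j ω) (U.φ j ω) p * conj (S.signal (U.h j ω) (U.φ j ω) q) ∂P +
        if p = q then ((∫ ω, ((distortionVar P S.κ U.x (U.h j ω) (S.τ p.1) p.2 : ℝ)) ∂P +
          S.ξ : ℝ) : ℂ) else 0 := by
    rw [← U.integral_pilotSignal_mul_conj j p q]
    have h := U.integral_pilotSignal_mul_conj_mul' j p q (F := fun _ _ => 1) measurable_const
      (memLp_const 1)
    simp only [mul_one] at h
    rw [h, integral_complex_ofReal]
    simp
  have hquad : ∑ p, ∑ q, conj (v p) * v q * S.Psi j p q = 0 := by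
    refine Finset.sum_eq_zero fun p _ => ?_
    have := congrFun hΨ p
    rw [Matrix.mulVec, dotProduct] at this
    simp_rw [mul_assoc, ← Finset.mul_sum, mul_comm (v _), this]
    simp
  have hsig : ∑ p, ∑ q, conj (v p) * v q *
      ∫ ω, S.signal (U.h j ω) (U.φ j ω) p * conj (S.signal (U.h j ω) (U.φ j ω) q) ∂P =
      ((∫ ω, ‖∑ p, S.signal (U.h j ω) (U.φ j ω) p * conj (v p)‖ ^ 2 ∂P : ℝ) : ℂ) := by
    have h := integral_sum_mul_conj_sum_mul (P := P)
      (f := fun p ω => S.signal (U.h j ω) (U.φ j ω) p * conj (v p))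
      (g := fun p ω => S.signal (U.h j ω) (U.φ j ω) p * conj (v p)) (w := fun _ => 1)
      (fun p q => integrable_mul_conj_mul ((hs p).mul_const _) ((hs q).mul_const _) (memLp_const 1))
    simp only [mul_one, Complex.mul_conj, Complex.normSq_eq_norm_sq] at h
    rw [← integral_complex_ofReal, h]
    refine Finset.sum_congr rfl fun p _ => Finset.sum_congr rfl fun q _ => ?_
    rw [← integral_const_mul]
    refine integral_congr_ae (ae_of_all _ fun ω => ?_)
    simp only [map_mul, Complex.conj_conj]
    ring
  simp_rw [hentry, mul_add, Finset.sum_add_distrib] at hquad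
  rw [hsig] at hquad
  simp only [mul_ite, mul_zero, Finset.sum_ite_eq, Finset.mem_univ, if_true,
    mul_comm (conj (v _)) (v _), Complex.mul_conj, Complex.normSq_eq_norm_sq] at hquad
  norm_cast at hquad
  have hnn (p : Fin B × Fin N) :
      0 ≤ ∫ ω, ((distortionVar P S.κ U.x (U.h j ω) (S.τ p.1) p.2 : ℝ)) ∂P :=
    integral_nonneg fun ω => NNReal.coe_nonneg _
  have hξ' : (0 : ℝ) < S.ξ := hξ
  have hterm (p : Fin B × Fin N) : 0 ≤ ‖v p‖ ^ 2 *
      (∫ ω, ((distortionVar P S.κ U.x (U.h j ω) (S.τ p.1) p.2 : ℝ)) ∂P + S.ξ) :=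
    mul_nonneg (by positivity) (add_nonneg (hnn p) hξ'.le)
  have hsum0 := Finset.sum_nonneg fun p (_ : p ∈ Finset.univ) => hterm p
  have hint1 : 0 ≤ ∫ ω, ‖∑ p, S.signal (U.h j ω) (U.φ j ω) p * conj (v p)‖ ^ 2 ∂P :=
    integral_nonneg fun ω => by positivity
  refine hv (funext fun p => ?_)
  have hz := (Finset.sum_eq_zero_iff_of_nonneg fun p _ => hterm p).1 (by linarith) p
    (Finset.mem_univ p)
  have := (mul_eq_zero.1 hz).resolve_right (add_pos_of_nonneg_of_pos (hnn p) hξ').ne'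
  simpa using this

section MRC

variable {j : Fin L} (k : Fin K) (t : Fin T)

lemma mrc_apply (hdet : IsUnit (S.Psi j).det) (ω : Ω) (n : Fin N) :
    U.mrc j k t ω n = ∑ b, S.coeff j k t (b, n) * U.pilotSignal j ω (b, n) :=
  S.sum_estMatrix_mul k t hdet n _

lemma memLp_mrc (hdet : IsUnit (S.Psi j).det) (n : Fin N) :
    MemLp (fun ω => U.mrc j k t ω n) 4 P := by
  simp_rw [U.mrc_apply k t hdet]
  exact memLp_finsetSum _ fun b _ => (U.memLp_pilotSignal j (b, n)).const_mul _

lemma integrable_norm_sq_mrc (hdet : IsUnit (S.Psi j).det) :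
    Integrable (fun ω => ‖WithLp.toLp 2 (U.mrc j k t ω)‖ ^ 2) P := by
  simp_rw [EuclideanSpace.norm_sq_eq]
  exact integrable_finsetSum _ fun n _ =>
    (memLp_two_iff_integrable_sq_norm (U.memLp_mrc k t hdet n).1).1
      ((U.memLp_mrc k t hdet n).mono_exponent (by norm_num))

lemma integral_norm_sq_mrc (hdet : IsUnit (S.Psi j).det) :
    ((∫ ω, ‖WithLp.toLp 2 (U.mrc j k t ω)‖ ^ 2 ∂P : ℝ) : ℂ) = (S.crossMat j k j k t).trace := by
  have hψ := U.memLp_pilotSignal j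
  have e (ω : Ω) : ((‖WithLp.toLp 2 (U.mrc j k t ω)‖ ^ 2 : ℝ) : ℂ) =
      ∑ n, U.mrc j k t ω n * conj (U.mrc j k t ω n) := by
    rw [EuclideanSpace.norm_sq_eq]
    push_cast
    simp [Complex.mul_conj, Complex.normSq_eq_norm_sq]
  have hint (n : Fin N) : Integrable (fun ω => U.mrc j k t ω n * conj (U.mrc j k t ω n)) P := by
    simpa using integrable_mul_conj_mul (U.memLp_mrc k t hdet n) (U.memLp_mrc k t hdet n)
      (memLp_const 1)
  rw [← integral_complex_ofReal]
  simp_rw [e]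
  rw [integral_finsetSum _ fun n _ => hint n, Matrix.trace]
  refine Finset.sum_congr rfl fun n _ => ?_
  rw [Matrix.diag_apply, S.crossMat_self_diag k t hdet]
  have h := integral_sum_mul_conj_sum_mul (P := P)
    (f := fun b ω => S.coeff j k t (b, n) * U.pilotSignal j ω (b, n))
    (g := fun b ω => S.coeff j k t (b, n) * U.pilotSignal j ω (b, n)) (w := fun _ => 1)
    (fun b b' => integrable_mul_conj_mul ((hψ _).const_mul _) ((hψ _).const_mul _)
      (memLp_const 1))
  simp only [mul_one] at h
  simp_rw [U.mrc_apply k t hdet]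
  rw [h]
  refine Finset.sum_congr rfl fun b₁ _ => Finset.sum_congr rfl fun b₂ _ => ?_
  rw [← U.integral_pilotSignal_mul_conj, ← integral_const_mul]
  refine integral_congr_ae (ae_of_all _ fun ω => ?_)
  simp only [map_mul]
  ring

lemma integrable_mrc_dot (hdet : IsUnit (S.Psi j).det) :
    Integrable (fun ω => star (U.mrc j k t ω) ⬝ᵥ U.effChannel j j k t ω) P := by
  refine integrable_finsetSum _ fun n _ => ?_
  exact integrable_mul_of_memLp_two ((U.memLp_mrc k t hdet n).conj.mono_exponent (by norm_num))
    ((U.memLp_effChannel j j k t n).mono_exponent (by norm_num))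

/-- The filter is correlated with the channel as with itself. -/
lemma integral_mrc_dot (hdet : IsUnit (S.Psi j).det) :
    ∫ ω, star (U.mrc j k t ω) ⬝ᵥ U.effChannel j j k t ω ∂P =
      ((∫ ω, ‖WithLp.toLp 2 (U.mrc j k t ω)‖ ^ 2 ∂P : ℝ) : ℂ) := by
  have hg := U.memLp_effChannel j j k t
  have hψ := U.memLp_pilotSignal j
  rw [← Complex.conj_ofReal, U.integral_norm_sq_mrc k t hdet, Matrix.trace, map_sum]
  have e (ω : Ω) (n : Fin N) : star (U.mrc j k t ω) n * U.effChannel j j k t ω n =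
      ∑ b, conj (S.coeff j k t (b, n)) *
        (U.effChannel j j k t ω n * conj (U.pilotSignal j ω (b, n))) := by
    rw [Pi.star_apply, Complex.star_def, U.mrc_apply k t hdet, map_sum, Finset.sum_mul]
    refine Finset.sum_congr rfl fun b _ => ?_
    rw [map_mul]
    ring
  have hint (n : Fin N) (b : Fin B) : Integrable (fun ω => conj (S.coeff j k t (b, n)) *
      (U.effChannel j j k t ω n * conj (U.pilotSignal j ω (b, n)))) P := by
    have := integrable_mul_conj_mul (hg n) (hψ (b, n)) (memLp_const 1)
    simp only [mul_one] at this
    exact this.const_mul _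
  simp_rw [dotProduct, e]
  rw [integral_finsetSum _ fun n _ => integrable_finsetSum _ fun b _ => hint n b]
  refine Finset.sum_congr rfl fun n _ => ?_
  rw [integral_finsetSum _ fun b _ => hint n b, Matrix.diag_apply, S.crossMat_diag k t hdet, map_sum]
  refine Finset.sum_congr rfl fun b _ => ?_
  rw [integral_const_mul, U.integral_effChannel_mul_conj_pilotSignal, if_pos rfl]
  simp [← S.conj_xRow]

/-! ### Second moments of the filter output -/

lemma integrable_norm_sq_mrc_dot (hdet : IsUnit (S.Psi j).det) {g : Ω → Fin N → ℂ}
    (hg : ∀ n, MemLp (fun ω => g ω n) 4 P) :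
    Integrable (fun ω => ‖star (U.mrc j k t ω) ⬝ᵥ g ω‖ ^ 2) P := by
  have h : MemLp (fun ω => star (U.mrc j k t ω) ⬝ᵥ g ω) 2 P :=
    memLp_finsetSum _ fun n _ => memLp_two_mul_of_memLp_four (U.memLp_mrc k t hdet n).conj (hg n)
  exact (memLp_two_iff_integrable_sq_norm h.1).1 h

lemma integral_norm_sq_mrc_dot (hdet : IsUnit (S.Psi j).det) {g : Ω → Fin N → ℂ}
    (hg : ∀ n, MemLp (fun ω => g ω n) 4 P) :
    ((∫ ω, ‖star (U.mrc j k t ω) ⬝ᵥ g ω‖ ^ 2 ∂P : ℝ) : ℂ) =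
      ∑ p, ∑ q, S.coeff j k t p * conj (S.coeff j k t q) *
        ∫ ω, U.pilotSignal j ω p * conj (U.pilotSignal j ω q) *
          (conj (g ω p.2) * g ω q.2) ∂P := by
  have hψ := U.memLp_pilotSignal j
  have hint (p q : Fin B × Fin N) : Integrable (fun ω =>
      (S.coeff j k t p * (U.pilotSignal j ω p * conj (g ω p.2))) *
        conj (S.coeff j k t q * (U.pilotSignal j ω q * conj (g ω q.2))) * 1) P := by
    simp only [mul_one]
    exact integrable_mul_of_memLp_two
      ((memLp_two_mul_of_memLp_four (hψ p) (hg p.2).conj).const_mul _)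
      ((memLp_two_mul_of_memLp_four (hψ q) (hg q.2).conj).const_mul _).conj
  have h := integral_sum_mul_conj_sum_mul (P := P) (w := fun _ => 1) hint
  simp only [mul_one] at h
  have e (ω : Ω) : ((‖star (U.mrc j k t ω) ⬝ᵥ g ω‖ ^ 2 : ℝ) : ℂ) =
      (∑ p, S.coeff j k t p * (U.pilotSignal j ω p * conj (g ω p.2))) *
        conj (∑ p, S.coeff j k t p * (U.pilotSignal j ω p * conj (g ω p.2))) := by
    have e' : ∑ p, S.coeff j k t p * (U.pilotSignal j ω p * conj (g ω p.2)) =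
        conj (star (U.mrc j k t ω) ⬝ᵥ g ω) := by
      rw [dotProduct, map_sum, Fintype.sum_prod_type_right]
      refine Finset.sum_congr rfl fun n _ => ?_
      rw [Pi.star_apply, map_mul, Complex.star_def, Complex.conj_conj, U.mrc_apply k t hdet,
        Finset.sum_mul]
      exact Finset.sum_congr rfl fun b _ => by ring
    rw [e', Complex.conj_conj, mul_comm, Complex.mul_conj, Complex.normSq_eq_norm_sq]
  rw [← integral_complex_ofReal]
  simp_rw [e]
  rw [h]
  refine Finset.sum_congr rfl fun p _ => Finset.sum_congr rfl fun q _ => ?_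
  rw [← integral_const_mul]
  refine integral_congr_ae (ae_of_all _ fun ω => ?_)
  simp only [map_mul, Complex.conj_conj]
  ring

end MRC

end Uplink

lemma sum_prod_prod_eq {α β : Type*} [Fintype α] [Fintype β] (f : α × β → α × β → ℂ) :
    ∑ p, ∑ q, f p q = ∑ n₁, ∑ n₂, ∑ b₁, ∑ b₂, f (b₁, n₁) (b₂, n₂) := by
  rw [Fintype.sum_prod_type_right]
  refine Finset.sum_congr rfl fun n₁ _ => ?_
  simp_rw [Fintype.sum_prod_type_right]
  rw [Finset.sum_comm]

namespace UplinkParams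

variable {L K N T B : ℕ} (S : UplinkParams L K N T B) {j : Fin L} (k : Fin K) (t : Fin T)

lemma trace_Lam_mul (l : Fin L) (m : Fin K) (M : Matrix (Fin N) (Fin N) ℂ) :
    (S.Lam j l m * M).trace = ∑ n, ((S.lam j l m n : ℝ) : ℂ) * M n n := by
  simp [Matrix.trace, Lam, Matrix.diagonal_mul]

/-- Second moments of filter outputs, when the cross-correlation kernel is `Y` between different
antennas and `Y + Z` at the same antenna. -/
lemma sum_coeff_mul (hdet : IsUnit (S.Psi j).det) (l : Fin L) (m : Fin K)
    (Y Z : Matrix (Fin B) (Fin B) ℂ) (R : Fin B × Fin N → Fin B × Fin N → ℂ)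
    (hR : ∀ p q, R p q = Y p.1 q.1 + if p.2 = q.2 then Z p.1 q.1 else 0) :
    ∑ p, ∑ q, S.coeff j k t p * conj (S.coeff j k t q) *
      ((if p.2 = q.2 then ((S.lam j l m p.2 : ℝ) : ℂ) * S.Psi j p q else 0) +
        ((S.lam j l m p.2 : ℝ) : ℂ) * ((S.lam j l m q.2 : ℝ) : ℂ) * R p q) =
    (S.Lam j l m * S.crossMat j k j k t).trace
      + ∑ n₁, ∑ n₂, ((S.lam j j k n₁ * S.lam j l m n₁ * S.lam j j k n₂ * S.lam j l m n₂ : ℝ) : ℂ)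
          * S.quad j k t Y n₁ n₂
      + ∑ n, (((S.lam j j k n * S.lam j l m n) ^ 2 : ℝ) : ℂ) * S.quad j k t Z n n := by
  have hinner (n₁ n₂ : Fin N) : ∑ b₁, ∑ b₂, S.coeff j k t (b₁, n₁) * conj (S.coeff j k t (b₂, n₂)) *
      ((if n₁ = n₂ then ((S.lam j l m n₁ : ℝ) : ℂ) * S.Psi j (b₁, n₁) (b₂, n₂) else 0) +
        ((S.lam j l m n₁ : ℝ) : ℂ) * ((S.lam j l m n₂ : ℝ) : ℂ) *
          (Y b₁ b₂ + if n₁ = n₂ then Z b₁ b₂ else 0)) =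
      (if n₁ = n₂ then ((S.lam j l m n₁ : ℝ) : ℂ) * S.crossMat j k j k t n₁ n₁ else 0) +
        ((S.lam j j k n₁ * S.lam j l m n₁ * S.lam j j k n₂ * S.lam j l m n₂ : ℝ) : ℂ)
          * S.quad j k t Y n₁ n₂ +
        if n₁ = n₂ then (((S.lam j j k n₁ * S.lam j l m n₁) ^ 2 : ℝ) : ℂ) * S.quad j k t Z n₁ n₁
        else 0 := by
    have hY : ((S.lam j j k n₁ * S.lam j l m n₁ * S.lam j j k n₂ * S.lam j l m n₂ : ℝ) : ℂ)
        * S.quad j k t Y n₁ n₂ = ((S.lam j l m n₁ : ℝ) : ℂ) * ((S.lam j l m n₂ : ℝ) : ℂ) *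
          (((S.lam j j k n₁ : ℝ) : ℂ) * ((S.lam j j k n₂ : ℝ) : ℂ) * S.quad j k t Y n₁ n₂) := by
      push_cast; ring
    have hZ : (((S.lam j j k n₁ * S.lam j l m n₁) ^ 2 : ℝ) : ℂ) * S.quad j k t Z n₁ n₁ =
        ((S.lam j l m n₁ : ℝ) : ℂ) * ((S.lam j l m n₁ : ℝ) : ℂ) *
          (((S.lam j j k n₁ : ℝ) : ℂ) * ((S.lam j j k n₁ : ℝ) : ℂ) * S.quad j k t Z n₁ n₁) := by
      push_cast; ring
    rw [hY, hZ, S.mul_quad_eq k t hdet, S.mul_quad_eq k t hdet, S.crossMat_self_diag k t hdet]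
    by_cases hn : n₁ = n₂
    · subst hn
      simp only [if_true, Finset.mul_sum, ← Finset.sum_add_distrib]
      exact Finset.sum_congr rfl fun b₁ _ => Finset.sum_congr rfl fun b₂ _ => by ring
    · simp only [hn, if_false, zero_add, add_zero, Finset.mul_sum]
      exact Finset.sum_congr rfl fun b₁ _ => Finset.sum_congr rfl fun b₂ _ => by ring
  simp_rw [hR]
  rw [sum_prod_prod_eq]
  simp_rw [hinner, Finset.sum_add_distrib]
  simp [trace_Lam_mul]

/-- The product of the decay factors to the data time is a rank-one kernel; its sum is the squared
modulus of the mean filter output. -/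
lemma sum_quad_vecMulVec (hdet : IsUnit (S.Psi j).det) (l : Fin L) (m : Fin K) :
    ∑ n₁, ∑ n₂, ((S.lam j j k n₁ * S.lam j l m n₁ * S.lam j j k n₂ * S.lam j l m n₂ : ℝ) : ℂ)
      * S.quad j k t (Matrix.vecMulVec (S.xCol l m t) (S.xRow l m t)) n₁ n₂ =
    ((‖(S.crossMat j k l m t).trace‖ ^ 2 : ℝ) : ℂ) := by
  rw [← Complex.normSq_eq_norm_sq, ← Complex.mul_conj, Matrix.trace, map_sum, Finset.sum_mul_sum]
  refine Finset.sum_congr rfl fun n₁ _ => Finset.sum_congr rfl fun n₂ _ => ?_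
  have hY : ((S.lam j j k n₁ * S.lam j l m n₁ * S.lam j j k n₂ * S.lam j l m n₂ : ℝ) : ℂ)
      * S.quad j k t (Matrix.vecMulVec (S.xCol l m t) (S.xRow l m t)) n₁ n₂ =
      ((S.lam j l m n₁ : ℝ) : ℂ) * ((S.lam j l m n₂ : ℝ) : ℂ) *
        (((S.lam j j k n₁ : ℝ) : ℂ) * ((S.lam j j k n₂ : ℝ) : ℂ) *
          S.quad j k t (Matrix.vecMulVec (S.xCol l m t) (S.xRow l m t)) n₁ n₂) := by
    push_cast; ring
  rw [hY, S.mul_quad_eq k t hdet, Matrix.diag_apply, Matrix.diag_apply, S.crossMat_diag k t hdet,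
    S.crossMat_diag k t hdet, map_sum, Finset.sum_mul_sum]
  simp only [Finset.mul_sum]
  refine Finset.sum_congr rfl fun b₁ _ => Finset.sum_congr rfl fun b₂ _ => ?_
  rw [Matrix.vecMulVec_apply]
  simp only [map_mul, ← S.conj_xRow, Complex.conj_conj, Complex.conj_ofReal]
  ring

/-- The distortion kernel, summed against the coefficients of the estimator. -/
lemma sum_coeff_mul_distortion (hdet : IsUnit (S.Psi j).det) :
    ∑ p, ∑ q, S.coeff j k t p * conj (S.coeff j k t q) *
      (if p.2 = q.2 then ((S.κ : ℝ) : ℂ) ^ 2 * ∑ l, ∑ m, ((S.p l m : ℝ) : ℂ) *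
        (((S.lam j l m p.2 : ℝ) : ℂ) * S.Psi j p q +
          ((S.lam j l m p.2 : ℝ) : ℂ) ^ 2 * S.X l m p.1 q.1) else 0) =
    ((S.κ : ℝ) : ℂ) ^ 2 * ∑ l, ∑ m, ((S.p l m : ℝ) : ℂ)
        * (S.Lam j l m * S.crossMat j k j k t).trace
      + ((S.κ : ℝ) : ℂ) ^ 2 * ∑ l, ∑ m, ∑ n, ((S.p l m : ℝ) : ℂ)
        * (((S.lam j j k n * S.lam j l m n) ^ 2 : ℝ) : ℂ) * S.quad j k t (S.X l m) n n := by
  -- the kernel of a single user has `Y = 0` and `Z = X`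
  have hone (l : Fin L) (m : Fin K) := S.sum_coeff_mul k t hdet l m 0 (S.X l m)
    (fun p q => if p.2 = q.2 then S.X l m p.1 q.1 else 0) (by simp)
  have hquad0 (n₁ n₂ : Fin N) : S.quad j k t 0 n₁ n₂ = 0 := by simp [S.quad_eq k t hdet]
  simp only [hquad0, mul_zero, Finset.sum_const_zero, add_zero] at hone
  have hsplit (p q : Fin B × Fin N) : S.coeff j k t p * conj (S.coeff j k t q) *
      (if p.2 = q.2 then ((S.κ : ℝ) : ℂ) ^ 2 * ∑ l, ∑ m, ((S.p l m : ℝ) : ℂ) *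
        (((S.lam j l m p.2 : ℝ) : ℂ) * S.Psi j p q +
          ((S.lam j l m p.2 : ℝ) : ℂ) ^ 2 * S.X l m p.1 q.1) else 0) =
      ∑ l, ∑ m, ((S.κ : ℝ) : ℂ) ^ 2 * ((S.p l m : ℝ) : ℂ) *
        (S.coeff j k t p * conj (S.coeff j k t q) *
          ((if p.2 = q.2 then ((S.lam j l m p.2 : ℝ) : ℂ) * S.Psi j p q else 0) +
            ((S.lam j l m p.2 : ℝ) : ℂ) * ((S.lam j l m q.2 : ℝ) : ℂ) *
              if p.2 = q.2 then S.X l m p.1 q.1 else 0)) := by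
    split_ifs with h
    · simp only [Finset.mul_sum, h]
      exact Finset.sum_congr rfl fun l _ => Finset.sum_congr rfl fun m _ => by ring
    · simp
  have hcomm {d : ℕ} (f : Fin B × Fin N → Fin B × Fin N → Fin d → ℂ) :
      ∑ p, ∑ q, ∑ a, f p q a = ∑ a, ∑ p, ∑ q, f p q a :=
    (Finset.sum_congr rfl fun p _ => Finset.sum_comm).trans Finset.sum_comm
  calc _ = ∑ l, ∑ m, ∑ p, ∑ q, ((S.κ : ℝ) : ℂ) ^ 2 * ((S.p l m : ℝ) : ℂ) *
        (S.coeff j k t p * conj (S.coeff j k t q) *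
          ((if p.2 = q.2 then ((S.lam j l m p.2 : ℝ) : ℂ) * S.Psi j p q else 0) +
            ((S.lam j l m p.2 : ℝ) : ℂ) * ((S.lam j l m q.2 : ℝ) : ℂ) *
              if p.2 = q.2 then S.X l m p.1 q.1 else 0)) := by
        simp_rw [hsplit]
        rw [hcomm]
        exact Finset.sum_congr rfl fun l _ => hcomm _
    _ = _ := by
        simp only [← Finset.mul_sum, hone]
        simp only [mul_add, Finset.mul_sum, Finset.sum_add_distrib]
        congr 1
        · exact Finset.sum_congr rfl fun l _ => Finset.sum_congr rfl fun m _ => by ring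
        · exact Finset.sum_congr rfl fun l _ => Finset.sum_congr rfl fun m _ =>
            Finset.sum_congr rfl fun n _ => by ring

end UplinkParams

/-! ### Optimality of the estimator -/

lemma lintegral_enorm_sq_toLp {N : ℕ} {Ω : Type*} [MeasurableSpace Ω] {P : Measure Ω}
    {g : Ω → Fin N → ℂ}
    (hg : ∀ n, MemLp (fun ω => g ω n) 2 P) :
    ∫⁻ ω, ‖WithLp.toLp 2 (g ω)‖ₑ ^ 2 ∂P = ENNReal.ofReal (∑ n, ∫ ω, ‖g ω n‖ ^ 2 ∂P) := by
  have hint (n : Fin N) : Integrable (fun ω => ‖g ω n‖ ^ 2) P :=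
    (memLp_two_iff_integrable_sq_norm (hg n).1).1 (hg n)
  rw [← integral_finsetSum _ fun n _ => hint n, ofReal_integral_eq_lintegral_ofReal
    (integrable_finsetSum _ fun n _ => hint n)
    (ae_of_all _ fun ω => Finset.sum_nonneg fun n _ => by positivity)]
  refine lintegral_congr fun ω => ?_
  have e : ∑ n, ‖g ω n‖ ^ 2 = ‖WithLp.toLp 2 (g ω)‖ ^ 2 := by rw [EuclideanSpace.norm_sq_eq]
  rw [e, ENNReal.ofReal_pow (norm_nonneg _), ofReal_norm]

namespace Uplink

variable {L K N T B : ℕ} {S : UplinkParams L K N T B}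
  {Ω : Type*} [MeasurableSpace Ω] {P : Measure Ω} [IsProbabilityMeasure P] (U : Uplink S P)

variable {j : Fin L} (k : Fin K) (t : Fin T)

/-- The estimation error is uncorrelated with the observation. -/
lemma integral_error_mul_conj_pilotSignal (hdet : IsUnit (S.Psi j).det) (n : Fin N)
    (q : Fin B × Fin N) :
    ∫ ω, (U.effChannel j j k t ω - S.estMatrix j j k t *ᵥ U.pilotSignal j ω) n *
      conj (U.pilotSignal j ω q) ∂P = 0 := by
  have hψ := U.memLp_pilotSignal j
  have hg := U.memLp_effChannel j j k t n
  have hint {f : Ω → ℂ} (hf : MemLp f 4 P) :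
      Integrable (fun ω => f ω * conj (U.pilotSignal j ω q)) P := by
    simpa using integrable_mul_conj_mul hf (hψ q) (memLp_const 1)
  have hsum : ∫ ω, (S.estMatrix j j k t *ᵥ U.pilotSignal j ω) n *
      conj (U.pilotSignal j ω q) ∂P = (S.estMatrix j j k t * S.Psi j) n q := by
    simp_rw [Matrix.mulVec, dotProduct, Finset.sum_mul, mul_assoc]
    rw [integral_finsetSum _ fun p _ => (hint (hψ p)).const_mul _, Matrix.mul_apply]
    refine Finset.sum_congr rfl fun p _ => ?_
    rw [integral_const_mul, integral_pilotSignal_mul_conj]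
  have hest : MemLp (fun ω => (S.estMatrix j j k t *ᵥ U.pilotSignal j ω) n) 4 P :=
    memLp_finsetSum _ fun p _ => (hψ p).const_mul _
  simp_rw [Pi.sub_apply, sub_mul]
  rw [integral_sub (hint hg) (hint hest), hsum, S.estMatrix_mul_Psi k t hdet,
    U.integral_effChannel_mul_conj_pilotSignal, UplinkParams.rowKron_apply, UplinkParams.Lam,
    Matrix.diagonal_apply]
  split_ifs <;> simp

/-- The orthogonality principle. -/
lemma isLMMSE_estMatrix (hdet : IsUnit (S.Psi j).det) :
    IsLMMSE P (U.effChannel j j k t) (U.pilotSignal j) (S.estMatrix j j k t) := by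
  intro W
  have hψ := U.memLp_pilotSignal j
  have hmem (M : Matrix (Fin N) (Fin B × Fin N) ℂ) (n : Fin N) :
      MemLp (fun ω => (M *ᵥ U.pilotSignal j ω) n) 4 P :=
    memLp_finsetSum _ fun p _ => (hψ p).const_mul _
  have herr (M : Matrix (Fin N) (Fin B × Fin N) ℂ) (n : Fin N) :
      MemLp (fun ω => (U.effChannel j j k t ω - M *ᵥ U.pilotSignal j ω) n) 4 P :=
    (U.memLp_effChannel j j k t n).sub (hmem M n)
  have herr2 (M : Matrix (Fin N) (Fin B × Fin N) ℂ) (n : Fin N) :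
      MemLp (fun ω => (U.effChannel j j k t ω - M *ᵥ U.pilotSignal j ω) n) 2 P :=
    (herr M n).mono_exponent (by norm_num)
  have hsq (M : Matrix (Fin N) (Fin B × Fin N) ℂ) (n : Fin N) := (memLp_two_iff_integrable_sq_norm
    (herr2 M n).1).1 (herr2 M n)
  rw [lintegral_enorm_sq_toLp (herr2 _), lintegral_enorm_sq_toLp (herr2 _)]
  refine ENNReal.ofReal_le_ofReal (Finset.sum_le_sum fun n _ => ?_)
  set A := S.estMatrix j j k t
  set e : Ω → ℂ := fun ω => (U.effChannel j j k t ω - A *ᵥ U.pilotSignal j ω) n with he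
  set d : Ω → ℂ := fun ω => ((A - W) *ᵥ U.pilotSignal j ω) n with hd
  have hed : Integrable (fun ω => e ω * conj (d ω)) P := by
    have := integrable_mul_conj_mul (herr A n) (hmem (A - W) n) (memLp_const 1)
    simp only [mul_one] at this
    exact this
  have horth : ∫ ω, e ω * conj (d ω) ∂P = 0 := by
    have e1 (ω : Ω) : e ω * conj (d ω) =
        ∑ q, conj ((A - W) n q) * (e ω * conj (U.pilotSignal j ω q)) := by
      rw [hd]
      simp only [Matrix.mulVec, dotProduct, map_sum, Finset.mul_sum, map_mul]
      exact Finset.sum_congr rfl fun q _ => by ring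
    simp_rw [e1]
    rw [integral_finsetSum]
    · refine Finset.sum_eq_zero fun q _ => ?_
      rw [integral_const_mul, U.integral_error_mul_conj_pilotSignal k t hdet, mul_zero]
    · intro q _
      have := integrable_mul_conj_mul (herr A n) (hψ q) (memLp_const 1)
      simp only [mul_one] at this
      exact this.const_mul _
  have hre : ∫ ω, (e ω * conj (d ω)).re ∂P = 0 := by
    have h := integral_re hed
    simp only [RCLike.re_eq_complex_re] at h
    rw [h, horth, Complex.zero_re]
  have hsplit (ω : Ω) : (U.effChannel j j k t ω - W *ᵥ U.pilotSignal j ω) n = e ω + d ω := by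
    simp [he, hd, Matrix.sub_mulVec]
  calc ∫ ω, ‖e ω‖ ^ 2 ∂P = ∫ ω, (‖e ω‖ ^ 2 + 2 * (e ω * conj (d ω)).re) ∂P := by
        have hr : Integrable (fun ω => (e ω * conj (d ω)).re) P := hed.re
        rw [integral_add (hsq A n) (hr.const_mul 2), integral_const_mul, hre, mul_zero, add_zero]
    _ ≤ ∫ ω, ‖(U.effChannel j j k t ω - W *ᵥ U.pilotSignal j ω) n‖ ^ 2 ∂P := by
        have hr : Integrable (fun ω => (e ω * conj (d ω)).re) P := hed.re
        refine integral_mono ((hsq A n).add (hr.const_mul 2)) (hsq W n) fun ω => ?_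
        simp only [hsplit]
        rw [← Complex.normSq_eq_norm_sq, ← Complex.normSq_eq_norm_sq, Complex.normSq_add]
        linarith [Complex.normSq_nonneg (d ω)]

end Uplink


theorem theorem2 {L K N T B : ℕ} (S : UplinkParams L K N T B) (hξ : 0 < S.ξ)
    {Ω : Type*} [MeasurableSpace Ω] (P : Measure Ω) [IsProbabilityMeasure P] (U : Uplink S P)
    (j : Fin L) (k : Fin K) (t : Fin T) (ht : t ∈ S.dataTimes) :
    -- the MRC filter is the LMMSE estimate of the effective channel
    IsLMMSE P (U.effChannel j j k t) (U.pilotSignal j) (S.estMatrix j j k t) ∧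
    -- squared norm of the filter
    (Integrable (fun ω => ‖WithLp.toLp 2 (U.mrc j k t ω)‖ ^ 2) P ∧
      ((∫ ω, ‖WithLp.toLp 2 (U.mrc j k t ω)‖ ^ 2 ∂P : ℝ) : ℂ) = (S.crossMat j k j k t).trace) ∧
    -- first moment
    (Integrable (fun ω => star (U.mrc j k t ω) ⬝ᵥ U.effChannel j j k t ω) P ∧
      ∫ ω, star (U.mrc j k t ω) ⬝ᵥ U.effChannel j j k t ω ∂P =
        ((∫ ω, ‖WithLp.toLp 2 (U.mrc j k t ω)‖ ^ 2 ∂P : ℝ) : ℂ)) ∧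
    -- second moments
    (∀ (l : Fin L) (m : Fin K),
      Integrable (fun ω => ‖star (U.mrc j k t ω) ⬝ᵥ U.effChannel j l m t ω‖ ^ 2) P ∧
      (U.CommonLO j →
        ((∫ ω, ‖star (U.mrc j k t ω) ⬝ᵥ U.effChannel j l m t ω‖ ^ 2 ∂P : ℝ) : ℂ) =
          (S.Lam j l m * S.crossMat j k j k t).trace
          + ∑ n₁, ∑ n₂, ((S.lam j j k n₁ * S.lam j l m n₁ * S.lam j j k n₂ * S.lam j l m n₂ : ℝ) : ℂ)
              * S.quad j k t (S.Xbar l m) n₁ n₂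
          + ∑ n, (((S.lam j j k n * S.lam j l m n) ^ 2 : ℝ) : ℂ)
              * S.quad j k t (((S.κ : ℝ) : ℂ) ^ 2 • S.Dsq l m) n n) ∧
      (U.SeparateLOs j →
        ((∫ ω, ‖star (U.mrc j k t ω) ⬝ᵥ U.effChannel j l m t ω‖ ^ 2 ∂P : ℝ) : ℂ) =
          (S.Lam j l m * S.crossMat j k j k t).trace
          + ((‖(S.crossMat j k l m t).trace‖ ^ 2 : ℝ) : ℂ)
          + ∑ n, (((S.lam j j k n * S.lam j l m n) ^ 2 : ℝ) : ℂ)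
              * S.quad j k t (S.X l m
                  - Matrix.vecMulVec (S.xCol l m t) (S.xRow l m t)) n n)) ∧
    -- distortion noise
    (Integrable (fun ω => ‖star (U.mrc j k t ω) ⬝ᵥ U.υ j ω t‖ ^ 2) P ∧
      ((∫ ω, ‖star (U.mrc j k t ω) ⬝ᵥ U.υ j ω t‖ ^ 2 ∂P : ℝ) : ℂ) =
        ((S.κ : ℝ) : ℂ) ^ 2 * ∑ l, ∑ m, ((S.p l m : ℝ) : ℂ)
            * (S.Lam j l m * S.crossMat j k j k t).trace
        + ((S.κ : ℝ) : ℂ) ^ 2 * ∑ l, ∑ m, ∑ n, ((S.p l m : ℝ) : ℂ)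
            * (((S.lam j j k n * S.lam j l m n) ^ 2 : ℝ) : ℂ) * S.quad j k t (S.X l m) n n) := by
  have hdet := U.isUnit_det_Psi hξ j
  refine ⟨U.isLMMSE_estMatrix k t hdet,
    ⟨U.integrable_norm_sq_mrc k t hdet, U.integral_norm_sq_mrc k t hdet⟩,
    ⟨U.integrable_mrc_dot k t hdet, U.integral_mrc_dot k t hdet⟩, fun l m => ⟨?_, ?_, ?_⟩, ?_, ?_⟩
  · exact U.integrable_norm_sq_mrc_dot k t hdet (U.memLp_effChannel j l m t)
  · intro hC
    rw [U.integral_norm_sq_mrc_dot k t hdet (U.memLp_effChannel j l m t)]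
    simp_rw [U.integral_pilotSignal_mul_conj_mul_effChannel]
    refine S.sum_coeff_mul k t hdet l m _ _ _ fun p q => ?_
    rw [Uplink.crossCorr, U.phaseCorr_of_commonLO hC, S.Xbar_apply, Matrix.smul_apply,
      UplinkParams.Dsq, Matrix.diagonal_apply]
    by_cases h1 : p.1 = q.1 <;> by_cases h2 : p.2 = q.2 <;> simp [Prod.ext_iff, h1, h2]
  · intro hS
    rw [U.integral_norm_sq_mrc_dot k t hdet (U.memLp_effChannel j l m t)]
    simp_rw [U.integral_pilotSignal_mul_conj_mul_effChannel]
    rw [← S.sum_quad_vecMulVec k t hdet]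
    refine S.sum_coeff_mul k t hdet l m _ _ _ fun p q => ?_
    obtain ⟨b₁, n₁⟩ := p
    obtain ⟨b₂, n₂⟩ := q
    by_cases hn : n₁ = n₂
    · subst hn
      rw [U.crossCorr_same]
      simp
    · rw [Uplink.crossCorr, U.phaseCorr_of_separateLOs hS t (by exact hn), Matrix.vecMulVec_apply,
        S.xCol_apply, S.xRow_apply]
      simp only [Prod.mk.injEq, hn, and_false, if_false, add_zero]
      ring
  · exact U.integrable_norm_sq_mrc_dot k t hdet (U.memLp_υ j t)
  · rw [U.integral_norm_sq_mrc_dot k t hdet (U.memLp_υ j t)]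
    simp_rw [U.integral_pilotSignal_mul_conj_mul_distortion' j ht]
    exact S.sum_coeff_mul_distortion k t hdet
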